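/- Let $n\ge 1$, and consider the standard probability space $(X,\mu)=(\{0,\dots,n-1\}\times\mathbb R/\mathbb Z,\ \nu\times\lambda)$, where $\nu$ is the uniform measure and $\lambda$ is Haar probability measure. Let $\mathrm{Aut}(X,\mu)$ be the group of measure preserving automorphisms of $(X,\mu)$, where automorphisms that agree almost everywhere are identified, with the uniform topology, given by the metric $d(R,S)=\mu(\{x: R(x)\ne S(x)\})$. Let $\alpha_0,\dots,\alpha_{n-1}$ be real numbers such that $1,\alpha_0,\dots,\alpha_{n-1}$ are linearly independent over $\mathbb Q$ (in particular every $\alpha_i$ is irrational), and let $T\in\mathrm{Aut}(X,\mu)$ be $T(i,x)=(i,x+\alpha_i)$. Let $\beta\in(0,1)$ be an irrational number smaller than all $\alpha_i$, put $A=\{0,\dots,n-1\}\times[0,\beta)$, where $[0,\beta)$ is regarded as a subset of $\mathbb R/\mathbb Z$, and suppose that $A$ and $T(A)$ are disjoint. Let $U=T_A$ be the involution of $X$ that equals $T$ on $A$, equals $T^{-1}$ on $T(A)$, and is the identity elsewhere. Let $E_T$ be the orbit equivalence relation of $T$, and let its full group $[E_T]$ be the set of those $S\in\mathrm{Aut}(X,\mu)$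 with $x\mathrel{E_T}S(x)$ for almost every $x$. Then $T$ and $U$ are topological generators of $[E_T]$: the closure in the uniform topology of the subgroup $\langle T,U\rangle$ generated by $T$ and $U$ equals $[E_T]$. -/

import Mathlib

open MeasureTheory Set

noncomputable section

namespace PMP

/-- Measure preserving bijections of `X` (measurable in both directions), as a group of
permutations of `X`, before identifying those that agree almost everywhere. -/
def preAut {X : Type*} [MeasurableSpace X] (μ : Measure X) : Subgroup (Equiv.Perm X) where
  carrier := {f | MeasurePreserving f μ μ ∧ MeasurePreserving f.symm μ μ}
  mul_mem' := fun hf hg => ⟨hf.1.comp hg.1, hg.2.comp hf.2⟩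
  one_mem' := ⟨MeasurePreserving.id μ, MeasurePreserving.id μ⟩
  inv_mem' := fun hf => ⟨hf.2, hf.1⟩

/-- The measure preserving bijections that agree with the identity almost everywhere. -/
def aeTrivial {X : Type*} [MeasurableSpace X] (μ : Measure X) : Subgroup (preAut μ) where
  carrier := {f | ∀ᵐ x ∂μ, f.1 x = x}
  mul_mem' := by
    intro f g hf hg
    filter_upwards [hg, g.2.1.quasiMeasurePreserving.ae hf] with x h1 h2
    exact h2.trans h1
  one_mem' := by
    change ∀ᵐ x ∂μ, (1 : preAut μ).1 x = x
    exact Filter.Eventually.of_forall fun _ => rfl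
  inv_mem' := by
    intro f hf
    change ∀ᵐ x ∂μ, (f⁻¹).1 x = x
    have hf' : ∀ᵐ x ∂μ, f.1 x = x := hf
    filter_upwards [hf'] with x hx
    exact f.1.symm_apply_eq.2 hx.symm

instance aeTrivial_normal {X : Type*} [MeasurableSpace X] (μ : Measure X) :
    (aeTrivial μ).Normal where
  conj_mem := by
    intro f hf g
    filter_upwards [g.2.2.quasiMeasurePreserving.ae hf] with x hx
    change g.1 (f.1 (g.1.symm x)) = x
    rw [hx, Equiv.apply_symm_apply]

/-- `Aut(X, μ)`: measure preserving automorphisms, identified when they agree almost everywhere. -/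
def Aut {X : Type*} [MeasurableSpace X] (μ : Measure X) : Type _ := preAut μ ⧸ aeTrivial μ

instance {X : Type*} [MeasurableSpace X] (μ : Measure X) : Group (Aut μ) :=
  inferInstanceAs (Group (preAut μ ⧸ aeTrivial μ))

/-- The class of a measure preserving bijection in `Aut(X, μ)`. -/
def Aut.mk {X : Type*} [MeasurableSpace X] (μ : Measure X) : preAut μ →* Aut μ :=
  QuotientGroup.mk' (aeTrivial μ)

theorem Aut.mk_surjective {X : Type*} [MeasurableSpace X] (μ : Measure X) :
    Function.Surjective (Aut.mk μ) :=
  QuotientGroup.mk'_surjective (aeTrivial μ)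

theorem ae_eq_of_inv_mul_mem {X : Type*} [MeasurableSpace X] {μ : Measure X} {S T : preAut μ}
    (h : S⁻¹ * T ∈ aeTrivial μ) : ∀ᵐ x ∂μ, S.1 x = T.1 x := by
  have h' : ∀ᵐ x ∂μ, S.1.symm (T.1 x) = x := h
  filter_upwards [h'] with x hx
  exact (S.1.symm_apply_eq.1 hx).symm

theorem Aut.mk_eq_mk {X : Type*} [MeasurableSpace X] {μ : Measure X} {S T : preAut μ} :
    Aut.mk μ S = Aut.mk μ T ↔ ∀ᵐ x ∂μ, S.1 x = T.1 x := by
  constructor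
  · intro h
    exact ae_eq_of_inv_mul_mem (QuotientGroup.eq.1 h)
  · intro h
    refine QuotientGroup.eq.2 ?_
    change ∀ᵐ x ∂μ, S.1.symm (T.1 x) = x
    filter_upwards [h] with x hx
    exact S.1.symm_apply_eq.2 hx.symm

/-- The uniform distance `d(S, T) = μ {x | S x ≠ T x}`. -/
def uniformDist {X : Type*} [MeasurableSpace X] (μ : Measure X) : Aut μ → Aut μ → ℝ :=
  Quotient.lift₂ (s₁ := QuotientGroup.leftRel (aeTrivial μ))
    (s₂ := QuotientGroup.leftRel (aeTrivial μ))
    (fun S T : preAut μ => μ.real {x | S.1 x ≠ T.1 x}) (by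
      intro S T S' T' hS hT
      have h1 := ae_eq_of_inv_mul_mem (QuotientGroup.leftRel_apply.1 hS)
      have h2 := ae_eq_of_inv_mul_mem (QuotientGroup.leftRel_apply.1 hT)
      refine measureReal_congr ?_
      filter_upwards [h1, h2] with x hx hy
      change (S.1 x ≠ T.1 x) = (S'.1 x ≠ T'.1 x)
      rw [hx, hy])

theorem uniformDist_mk {X : Type*} [MeasurableSpace X] (μ : Measure X) (S T : preAut μ) :
    uniformDist μ (Aut.mk μ S) (Aut.mk μ T) = μ.real {x | S.1 x ≠ T.1 x} := rfl

/-- `Aut(X, μ)` carries the uniform topology, given by the uniform distance. -/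
instance {X : Type*} [MeasurableSpace X] (μ : Measure X) [IsFiniteMeasure μ] :
    MetricSpace (Aut μ) where
  dist := uniformDist μ
  dist_self := by
    intro S
    obtain ⟨S, rfl⟩ := Aut.mk_surjective μ S
    simp [uniformDist_mk]
  dist_comm := by
    intro S T
    obtain ⟨S, rfl⟩ := Aut.mk_surjective μ S
    obtain ⟨T, rfl⟩ := Aut.mk_surjective μ T
    simp only [uniformDist_mk, ne_comm]
  dist_triangle := by
    intro R S T
    obtain ⟨R, rfl⟩ := Aut.mk_surjective μ R
    obtain ⟨S, rfl⟩ := Aut.mk_surjective μ S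
    obtain ⟨T, rfl⟩ := Aut.mk_surjective μ T
    simp only [uniformDist_mk]
    refine (measureReal_mono ?_).trans (measureReal_union_le _ _)
    intro x hx
    by_contra h
    simp only [mem_union, mem_ofPred_eq, not_or, not_not] at h
    exact hx (h.1.trans h.2)
  eq_of_dist_eq_zero := by
    intro S T h
    obtain ⟨S, rfl⟩ := Aut.mk_surjective μ S
    obtain ⟨T, rfl⟩ := Aut.mk_surjective μ T
    change uniformDist μ _ _ = 0 at h
    rw [uniformDist_mk, measureReal_eq_zero_iff] at h
    exact Aut.mk_eq_mk.2 (ae_iff.2 h)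

/-- The full group `[E]`: the automorphisms `S` with `x E S(x)` for almost every `x`. -/
def fullGroup {X : Type*} [MeasurableSpace X] (μ : Measure X) (E : Setoid X) :
    Subgroup (Aut μ) where
  carrier := {f | ∃ S : preAut μ, Aut.mk μ S = f ∧ ∀ᵐ x ∂μ, E x (S.1 x)}
  mul_mem' := by
    rintro _ _ ⟨S, rfl, hS⟩ ⟨T, rfl, hT⟩
    refine ⟨S * T, map_mul _ _ _, ?_⟩
    filter_upwards [hT, T.2.1.quasiMeasurePreserving.ae hS] with x h1 h2
    exact E.trans h1 h2
  one_mem' := ⟨1, map_one _, Filter.Eventually.of_forall fun x => E.refl x⟩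
  inv_mem' := by
    rintro _ ⟨S, rfl, hS⟩
    refine ⟨S⁻¹, map_inv _ _, ?_⟩
    filter_upwards [S.2.2.quasiMeasurePreserving.ae hS] with x hx
    have hx' : E (S.1.symm x) (S.1 (S.1.symm x)) := hx
    rw [Equiv.apply_symm_apply] at hx'
    exact E.symm hx'

/-- The elements of `s` are topological generators for the full group `[E]`: the closure, in the
uniform topology, of the group that they generate equals `[E]`. -/
def AreTopologicalGenerators {X : Type*} [MeasurableSpace X] (μ : Measure X) [IsFiniteMeasure μ]
    (s : Set (Aut μ)) (E : Setoid X) : Prop :=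
  closure (Subgroup.closure s : Set (Aut μ)) = (fullGroup μ E : Set (Aut μ))

/-- `E_T`, the orbit equivalence relation of `T`: `x E_T y` iff `y = T ^ k x` for some `k : ℤ`. -/
def orbitEquiv {X : Type*} [MeasurableSpace X] {μ : Measure X} (T : preAut μ) : Setoid X :=
  Equiv.Perm.SameCycle.setoid T.1

open Classical in
/-- The map `T_A`, equal to `T` on `A`, to `T⁻¹` on `T(A)`, and to the identity elsewhere. -/
def swapFun {X : Type*} (T : Equiv.Perm X) (A : Set X) (x : X) : X :=
  if x ∈ A then T x else if x ∈ T '' A then T.symm x else x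

theorem swapFun_involutive {X : Type*} (T : Equiv.Perm X) (A : Set X)
    (hd : Disjoint A (T '' A)) : Function.Involutive (swapFun T A) := by
  intro x
  by_cases h : x ∈ A
  · have h1 : T x ∈ T '' A := mem_image_of_mem _ h
    have h2 : T x ∉ A := fun h' => disjoint_left.1 hd h' h1
    have e : swapFun T A x = T x := by simp only [swapFun, if_pos h]
    rw [e]
    simp only [swapFun, if_neg h2, if_pos h1, Equiv.symm_apply_apply]
  · by_cases h1 : x ∈ T '' A
    · have h2 : T.symm x ∈ A := by
        obtain ⟨y, hy, rfl⟩ := h1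
        simpa using hy
      have e : swapFun T A x = T.symm x := by simp only [swapFun, if_neg h, if_pos h1]
      rw [e]
      simp only [swapFun, if_pos h2, Equiv.apply_symm_apply]
    · have e : swapFun T A x = x := by simp only [swapFun, if_neg h, if_neg h1]
      rw [e, e]

theorem measurableSet_image_preAut {X : Type*} [MeasurableSpace X] {μ : Measure X} (T : preAut μ)
    {A : Set X} (hA : MeasurableSet A) : MeasurableSet (T.1 '' A) := by
  rw [Equiv.image_eq_preimage_symm]
  exact T.2.2.measurable hA

theorem measurePreserving_swapFun {X : Type*} [MeasurableSpace X] {μ : Measure X} (T : preAut μ)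
    (A : Set X) (hA : MeasurableSet A) (hd : Disjoint A (T.1 '' A)) :
    MeasurePreserving (swapFun T.1 A) μ μ := by
  have hTA := measurableSet_image_preAut T hA
  have hm : Measurable (swapFun T.1 A) :=
    Measurable.ite hA T.2.1.measurable (Measurable.ite hTA T.2.2.measurable measurable_id)
  refine ⟨hm, Measure.ext fun s hs => ?_⟩
  rw [Measure.map_apply hm hs]
  have key : ∀ u : Set X, MeasurableSet u →
      μ u = μ (u ∩ A) + (μ (u ∩ T.1 '' A) + μ ((u \ A) \ T.1 '' A)) := by
    intro u hu
    rw [← measure_inter_add_sdiff u hA, ← measure_inter_add_sdiff (u \ A) hTA]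
    congr 3
    ext x
    simp only [mem_inter_iff, mem_sdiff]
    exact ⟨fun h => ⟨h.1.1, h.2⟩, fun h => ⟨⟨h.1, fun h' => disjoint_left.1 hd h' h.2⟩, h.2⟩⟩
  rw [key _ (hm hs), key s hs]
  have e1 : swapFun T.1 A ⁻¹' s ∩ A = T.1 ⁻¹' (s ∩ T.1 '' A) := by
    ext x
    simp only [mem_inter_iff, mem_preimage, T.1.injective.mem_set_image]
    refine and_congr_left fun h => ?_
    simp only [swapFun, if_pos h]
  have e2 : swapFun T.1 A ⁻¹' s ∩ T.1 '' A = T.1.symm ⁻¹' (s ∩ A) := by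
    ext x
    rw [Equiv.image_eq_preimage_symm] at hd ⊢
    simp only [mem_inter_iff, mem_preimage]
    refine and_congr_left fun h => ?_
    have h' : x ∉ A := fun h' => disjoint_left.1 hd h' h
    have h'' : x ∈ T.1 '' A := by rw [Equiv.image_eq_preimage_symm]; exact h
    simp only [swapFun, if_neg h', if_pos h'']
  have e3 : (swapFun T.1 A ⁻¹' s \ A) \ T.1 '' A = (s \ A) \ T.1 '' A := by
    ext x
    simp only [mem_sdiff, mem_preimage]
    refine and_congr_left fun h => and_congr_left fun h' => ?_
    simp only [swapFun, if_neg h, if_neg h']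
  rw [e1, e2, e3, T.2.1.measure_preimage (hs.inter hTA).nullMeasurableSet,
    T.2.2.measure_preimage (hs.inter hA).nullMeasurableSet, ← add_assoc, ← add_assoc,
    add_comm (μ (s ∩ A))]

/-- The involution `T_A`, for a measurable set `A` that is disjoint from `T(A)`. -/
def swap {X : Type*} [MeasurableSpace X] {μ : Measure X} (T : preAut μ)
    (A : Set X) (hA : MeasurableSet A) (hd : Disjoint A (T.1 '' A)) : preAut μ :=
  ⟨(swapFun_involutive T.1 A hd).toPerm,
    measurePreserving_swapFun T A hA hd, measurePreserving_swapFun T A hA hd⟩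

/-- The product of the uniform measure on `n = {0, …, n - 1}` and Haar measure on `ℝ/ℤ`. -/
def circlesMeasure (n : ℕ) : Measure (Fin n × UnitAddCircle) :=
  (ProbabilityTheory.uniformOn (Set.univ : Set (Fin n))).prod AddCircle.haarAddCircle

instance (n : ℕ) [NeZero n] : IsProbabilityMeasure (circlesMeasure n) := by
  unfold circlesMeasure
  infer_instance

/-- The bijection `(i, x) ↦ (i, x + α i)` of `n × ℝ/ℤ`. -/
def rotationPerm {n : ℕ} (α : Fin n → ℝ) : Equiv.Perm (Fin n × UnitAddCircle) where
  toFun p := (p.1, p.2 + (α p.1 : UnitAddCircle))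
  invFun p := (p.1, p.2 - (α p.1 : UnitAddCircle))
  left_inv p := by simp
  right_inv p := by simp

theorem measurePreserving_rotation {n : ℕ} [NeZero n] (α : Fin n → ℝ) :
    MeasurePreserving (fun p : Fin n × UnitAddCircle => (p.1, p.2 + (α p.1 : UnitAddCircle)))
      (circlesMeasure n) (circlesMeasure n) := by
  refine (MeasurePreserving.id _).skew_product (g := fun i x => x + (α i : UnitAddCircle)) ?_ ?_
  · exact measurable_snd.add ((measurable_of_finite fun i : Fin n => (α i : UnitAddCircle)).comp
      measurable_fst)
  · exact Filter.Eventually.of_forall fun i =>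
      (measurePreserving_add_right AddCircle.haarAddCircle (α i : UnitAddCircle)).map_eq

/-- The automorphism `T(i, x) = (i, x + α i)` of `n × ℝ/ℤ`. -/
def rotation {n : ℕ} [NeZero n] (α : Fin n → ℝ) : preAut (circlesMeasure n) :=
  ⟨rotationPerm α, measurePreserving_rotation α, by
    have h := measurePreserving_rotation (fun i => -α i)
    have e : ((rotationPerm α).symm : Fin n × UnitAddCircle → Fin n × UnitAddCircle) =
        fun p => (p.1, p.2 + ((-α p.1 : ℝ) : UnitAddCircle)) := by
      funext p
      change (p.1, p.2 - (α p.1 : UnitAddCircle)) = _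
      rw [AddCircle.coe_neg, sub_eq_add_neg]
    rw [e]
    exact h⟩

/-- The set `n × [0, β)`, where `[0, β)` is the image in `ℝ/ℤ` of the real interval. -/
def strip (n : ℕ) (β : ℝ) : Set (Fin n × UnitAddCircle) :=
  univ ×ˢ ((fun t : ℝ => (t : UnitAddCircle)) '' Ico 0 β)

theorem measurableSet_strip (n : ℕ) (β : ℝ) : MeasurableSet (strip n β) := by
  refine MeasurableSet.univ.prod ?_
  rcases lt_or_ge 1 β with h | h
  · have : (fun t : ℝ => (t : UnitAddCircle)) '' Ico 0 β = univ := by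
      refine eq_univ_of_univ_subset ?_
      have h1 := AddCircle.coe_image_Ico_eq (p := (1 : ℝ)) 0
      rw [← h1]
      exact image_mono (Ico_subset_Ico_right (by linarith))
    rw [this]
    exact MeasurableSet.univ
  · have : (fun t : ℝ => (t : UnitAddCircle)) '' Ico 0 β =
        (AddCircle.measurableEquivIco 1 0) ⁻¹' (Subtype.val ⁻¹' Ico 0 β) := by
      ext x
      constructor
      · rintro ⟨t, ht, rfl⟩
        have ht' : t ∈ Ico (0 : ℝ) (0 + 1) := ⟨ht.1, by linarith [ht.2]⟩
        change ((AddCircle.equivIco 1 0 (t : UnitAddCircle) : ℝ)) ∈ Ico 0 β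
        rw [AddCircle.equivIco_coe_eq ht']
        exact ht
      · intro hx
        exact ⟨_, hx, (AddCircle.equivIco (1 : ℝ) 0).symm_apply_apply x⟩
    rw [this]
    exact (AddCircle.measurableEquivIco 1 0).measurable (measurable_subtype_coe measurableSet_Ico)

end PMP

end

namespace PMP

open Filter Topology

/-! Let `G` be the uniform closure of the group generated by `T` and `U`. Full groups are closed, so
only `[E_T] ≤ G` needs an argument, and it consists in showing that `G` contains more and more
involutions `R_C`.

Conjugating `U` by powers of `T` translates the strip by multiples of `(α₀, …, αₙ₋₁)`. By
Kronecker's theorem these are dense in the torus, so `G` contains the involution over every strip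
whose arcs are translated independently (`swapMem_shiftedStrip`). Moving one arc by `s` and
multiplying the two involutions cancels everything but two short arcs of that circle, at distance
`β`. As `β` is irrational, the distance can be changed to any other, in particular to `s`, where the
two arcs merge into one (`swapMem_arc`).

Arcs generate the Borel sets, so `G` contains `T_C` for all measurable `C` in a short arc
(`swapMem_of_subset_arc`). Conjugation of such involutions extends this to powers of `T`
(`exists_swapMem_rotation_zpow`). Finally, any `S` in the full group agrees at each point with a
power of `T`, and a greedy exhaustion corrects `S` to the identity by these involutions
(`fullGroup_le_of_swapMem`). -/

/-! ### The uniform topology: bi-invariant metric and topological group. -/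

theorem Aut.dist_mk {X : Type*} [MeasurableSpace X] {μ : Measure X} [IsFiniteMeasure μ]
    (S T : preAut μ) : dist (Aut.mk μ S) (Aut.mk μ T) = μ.real {x | S.1 x ≠ T.1 x} := rfl

theorem measureReal_preimage_preAut {X : Type*} [MeasurableSpace X] {μ : Measure X} (g : preAut μ)
    (s : Set X) : μ.real (g.1 ⁻¹' s) = μ.real s := by
  let e : X ≃ᵐ X := ⟨g.1, g.2.1.measurable, g.2.2.measurable⟩
  have h : MeasurePreserving e μ μ := g.2.1
  exact congrArg ENNReal.toReal (h.measure_preimage_equiv s)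

theorem Aut.dist_mul_left {X : Type*} [MeasurableSpace X] {μ : Measure X} [IsFiniteMeasure μ]
    (f g h : Aut μ) : dist (f * g) (f * h) = dist g h := by
  obtain ⟨f, rfl⟩ := Aut.mk_surjective μ f
  obtain ⟨g, rfl⟩ := Aut.mk_surjective μ g
  obtain ⟨h, rfl⟩ := Aut.mk_surjective μ h
  rw [← map_mul, ← map_mul, Aut.dist_mk, Aut.dist_mk]
  congr 1
  ext x
  exact f.1.injective.ne_iff

theorem Aut.dist_mul_right {X : Type*} [MeasurableSpace X] {μ : Measure X} [IsFiniteMeasure μ]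
    (f g h : Aut μ) : dist (g * f) (h * f) = dist g h := by
  obtain ⟨f, rfl⟩ := Aut.mk_surjective μ f
  obtain ⟨g, rfl⟩ := Aut.mk_surjective μ g
  obtain ⟨h, rfl⟩ := Aut.mk_surjective μ h
  rw [← map_mul, ← map_mul, Aut.dist_mk, Aut.dist_mk]
  exact measureReal_preimage_preAut f {x | g.1 x ≠ h.1 x}

theorem Aut.dist_inv_inv {X : Type*} [MeasurableSpace X] {μ : Measure X} [IsFiniteMeasure μ]
    (f g : Aut μ) : dist f⁻¹ g⁻¹ = dist f g := by
  rw [← Aut.dist_mul_left f, ← Aut.dist_mul_right g, dist_comm]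
  simp

instance {X : Type*} [MeasurableSpace X] (μ : Measure X) [IsFiniteMeasure μ] :
    IsTopologicalGroup (Aut μ) where
  continuous_mul := by
    have : LipschitzWith 2 fun p : Aut μ × Aut μ => p.1 * p.2 := by
      refine LipschitzWith.of_dist_le_mul fun p q => ?_
      have h1 := dist_triangle (p.1 * p.2) (q.1 * p.2) (q.1 * q.2)
      rw [Aut.dist_mul_right, Aut.dist_mul_left] at h1
      have h2 : dist p.1 q.1 ≤ dist p q := le_max_left _ _
      have h3 : dist p.2 q.2 ≤ dist p q := le_max_right _ _
      simp only [NNReal.coe_ofNat]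
      linarith
    exact this.continuous
  continuous_inv := (Isometry.of_dist_eq Aut.dist_inv_inv).continuous

/-- Full groups are closed in the uniform topology. -/
theorem isClosed_fullGroup {X : Type*} [MeasurableSpace X] (μ : Measure X) [IsFiniteMeasure μ]
    (E : Setoid X) : IsClosed (fullGroup μ E : Set (Aut μ)) := by
  refine isClosed_of_closure_subset fun f hf => ?_
  obtain ⟨S, rfl⟩ := Aut.mk_surjective μ f
  refine ⟨S, rfl, ?_⟩
  rw [ae_iff, ← measureReal_eq_zero_iff]
  refine le_antisymm (le_of_forall_pos_le_add fun ε hε => ?_) measureReal_nonneg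
  obtain ⟨_, ⟨R, rfl, hR⟩, hd⟩ := Metric.mem_closure_iff.1 hf ε hε
  rw [Aut.dist_mk] at hd
  rw [ae_iff, ← measureReal_eq_zero_iff] at hR
  have h1 : {x | ¬ E x (S.1 x)} ⊆ {x | ¬ E x (R.1 x)} ∪ {x | S.1 x ≠ R.1 x} := by
    intro x hx
    by_contra h
    simp only [mem_union, mem_ofPred_eq, not_or, not_not] at h
    exact hx (h.2 ▸ h.1)
  have h2 := (measureReal_mono (μ := μ) h1).trans (measureReal_union_le _ _)
  linarith

/-! ### Algebra of the involutions `R_A`. -/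

theorem swapFun_eq_ite {X : Type*} (R : Equiv.Perm X) (A : Set X) (x : X) [Decidable (x ∈ A)]
    [Decidable (R.symm x ∈ A)] :
    swapFun R A x = if x ∈ A then R x else if R.symm x ∈ A then R.symm x else x := by
  have : x ∈ R '' A ↔ R.symm x ∈ A := by rw [Equiv.image_eq_preimage_symm]; rfl
  simp only [swapFun, this]

theorem disjoint_image_iff {X : Type*} {R : Equiv.Perm X} {A B : Set X} :
    Disjoint A (R '' B) ↔ ∀ x ∈ B, R x ∉ A := by
  rw [disjoint_right]
  exact forall_mem_image

/-- `R_A` belongs to the subgroup `G`; part of the meaning is that `R_A` is defined. -/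
def SwapMem {X : Type*} [MeasurableSpace X] {μ : Measure X} (G : Subgroup (Aut μ)) (R : preAut μ)
    (A : Set X) : Prop :=
  ∃ (hA : MeasurableSet A) (hd : Disjoint A (R.1 '' A)), Aut.mk μ (swap R A hA hd) ∈ G

theorem swap_union {X : Type*} [MeasurableSpace X] {μ : Measure X} (R : preAut μ) {A B : Set X}
    (hA : MeasurableSet A) (hB : MeasurableSet B) (hAB : Disjoint A B)
    (hd : Disjoint (A ∪ B) (R.1 '' (A ∪ B))) (hdA : Disjoint A (R.1 '' A))
    (hdB : Disjoint B (R.1 '' B)) :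
    swap R (A ∪ B) (hA.union hB) hd = swap R A hA hdA * swap R B hB hdB := by
  classical
  refine Subtype.ext (Equiv.ext fun x => ?_)
  change swapFun R.1 (A ∪ B) x = swapFun R.1 A (swapFun R.1 B x)
  have e : ∀ y, R.1 (R.1.symm y) = y := R.1.apply_symm_apply
  have e' : ∀ y, R.1.symm (R.1 y) = y := R.1.symm_apply_apply
  rw [disjoint_image_iff] at hd
  rw [disjoint_left] at hAB
  simp only [swapFun_eq_ite, mem_union] at hd ⊢
  grind

theorem swap_mul_self {X : Type*} [MeasurableSpace X] {μ : Measure X} (R : preAut μ) {A : Set X}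
    (hA : MeasurableSet A) (hd : Disjoint A (R.1 '' A)) :
    swap R A hA hd * swap R A hA hd = 1 :=
  Subtype.ext (Equiv.ext fun x => swapFun_involutive R.1 A hd x)

theorem swap_commuting_conj {X : Type*} [MeasurableSpace X] {μ : Measure X} (R g : preAut μ)
    (hg : Commute g R) {A : Set X} (hA : MeasurableSet A) (hd : Disjoint A (R.1 '' A))
    (hA' : MeasurableSet (g.1 '' A)) (hd' : Disjoint (g.1 '' A) (R.1 '' (g.1 '' A))) :
    swap R (g.1 '' A) hA' hd' = g * swap R A hA hd * g⁻¹ := by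
  classical
  rw [eq_mul_inv_iff_mul_eq]
  refine Subtype.ext (Equiv.ext fun x => ?_)
  change swapFun R.1 (g.1 '' A) (g.1 x) = g.1 (swapFun R.1 A x)
  have c : ∀ y, g.1 (R.1 y) = R.1 (g.1 y) := fun y =>
    congrArg (fun h : preAut μ => h.1 y) hg.eq
  have c' : ∀ y, R.1.symm (g.1 y) = g.1 (R.1.symm y) := fun y => by
    rw [Equiv.symm_apply_eq, ← c, Equiv.apply_symm_apply]
  simp only [swapFun_eq_ite, c', g.1.injective.mem_set_image]
  split_ifs <;> simp [c]

theorem swapFun_of_mem {X : Type*} {R : Equiv.Perm X} {A : Set X} {x : X} (hx : x ∈ A) :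
    swapFun R A x = R x := if_pos hx

theorem swapFun_apply_of_mem {X : Type*} {R : Equiv.Perm X} {A : Set X}
    (hd : Disjoint A (R '' A)) {x : X} (hx : x ∈ A) : swapFun R A (R x) = x := by
  rw [← swapFun_of_mem hx, swapFun_involutive R A hd]

theorem swapFun_of_notMem {X : Type*} {R : Equiv.Perm X} {A : Set X} {x : X} (hx : x ∉ A)
    (hx' : x ∉ R '' A) : swapFun R A x = x := by
  rw [swapFun, if_neg hx, if_neg hx']

/-- As with transpositions, `(a c) = (b c)(a b)(b c)`, applied to `a ∈ A`, `b = R a`, `c = R' b`.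
This is the passage from `T` to its powers. -/
theorem swap_comp {X : Type*} [MeasurableSpace X] {μ : Measure X} (R R' : preAut μ) {A : Set X}
    (hA : MeasurableSet A) (hA' : MeasurableSet (R.1 '' A)) (hd : Disjoint A (R.1 '' A))
    (hd' : Disjoint (R.1 '' A) (R'.1 '' (R.1 '' A))) (hd2 : Disjoint A ((R' * R).1 '' A)) :
    swap (R' * R) A hA hd2 =
      swap R' (R.1 '' A) hA' hd' * swap R A hA hd * swap R' (R.1 '' A) hA' hd' := by
  refine Subtype.ext (Equiv.ext fun x => ?_)
  change swapFun (R' * R).1 A x =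
    swapFun R'.1 (R.1 '' A) (swapFun R.1 A (swapFun R'.1 (R.1 '' A) x))
  have hc : (R' * R).1 '' A = R'.1 '' (R.1 '' A) := by rw [image_image]; rfl
  have m : ∀ y ∈ A, R.1 y ∈ R.1 '' A := fun y hy => mem_image_of_mem _ hy
  have m' : ∀ y ∈ A, R'.1 (R.1 y) ∈ R'.1 '' (R.1 '' A) := fun y hy => mem_image_of_mem _ (m y hy)
  have hd3 := hd2
  rw [hc] at hd3
  by_cases h1 : x ∈ A
  · rw [swapFun_of_mem h1, swapFun_of_notMem (disjoint_left.1 hd h1) (disjoint_left.1 hd3 h1),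
      swapFun_of_mem h1, swapFun_of_mem (m x h1)]
    rfl
  by_cases h2 : x ∈ R.1 '' A
  · obtain ⟨y, hy, rfl⟩ := h2
    have h4 : R.1 y ∉ R'.1 '' (R.1 '' A) := disjoint_left.1 hd' (m y hy)
    rw [swapFun_of_notMem h1 (by rwa [hc]), swapFun_of_mem (m y hy),
      swapFun_of_notMem (disjoint_right.1 hd3 (m' y hy)) (disjoint_right.1 hd' (m' y hy)),
      swapFun_apply_of_mem hd' (m y hy)]
  by_cases h3 : x ∈ R'.1 '' (R.1 '' A)
  · obtain ⟨_, ⟨y, hy, rfl⟩, rfl⟩ := h3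
    rw [swapFun_apply_of_mem hd' (m y hy), swapFun_apply_of_mem hd hy,
      swapFun_of_notMem (disjoint_left.1 hd hy) (disjoint_left.1 hd3 hy)]
    exact swapFun_apply_of_mem hd2 hy
  · rw [swapFun_of_notMem h1 (by rwa [hc]), swapFun_of_notMem h2 h3, swapFun_of_notMem h1 h2,
      swapFun_of_notMem h2 h3]

theorem swap_symm {X : Type*} [MeasurableSpace X] {μ : Measure X} (R : preAut μ) {A : Set X}
    (hA : MeasurableSet A) (hd : Disjoint A (R.1 '' A)) (hA' : MeasurableSet (R.1 '' A))
    (hd' : Disjoint (R.1 '' A) ((R⁻¹).1 '' (R.1 '' A))) :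
    swap R⁻¹ (R.1 '' A) hA' hd' = swap R A hA hd := by
  classical
  refine Subtype.ext (Equiv.ext fun x => ?_)
  change swapFun (R⁻¹).1 (R.1 '' A) x = swapFun R.1 A x
  have e : ∀ y, R.1 (R.1.symm y) = y := R.1.apply_symm_apply
  have e' : ∀ y, R.1.symm (R.1 y) = y := R.1.symm_apply_apply
  have m : ∀ y, y ∈ R.1 '' A ↔ R.1.symm y ∈ A := fun y => by
    rw [Equiv.image_eq_preimage_symm]; rfl
  have c : ∀ y, (R⁻¹).1 y = R.1.symm y := fun y => rfl
  have c' : ∀ y, (R⁻¹).1.symm y = R.1 y := fun y => rfl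
  rw [disjoint_image_iff] at hd
  simp only [swapFun_eq_ite, m, c, c'] at hd ⊢
  grind

/-- The two involutions can differ at `x` only if `x` or `R⁻¹ x` lies in the symmetric difference,
whence the factor 2. -/
theorem dist_swap_le {X : Type*} [MeasurableSpace X] {μ : Measure X} [IsFiniteMeasure μ]
    (R : preAut μ) {A B : Set X} (hA : MeasurableSet A) (hB : MeasurableSet B)
    (hdA : Disjoint A (R.1 '' A)) (hdB : Disjoint B (R.1 '' B)) :
    dist (Aut.mk μ (swap R A hA hdA)) (Aut.mk μ (swap R B hB hdB)) ≤
      2 * μ.real (symmDiff A B) := by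
  classical
  rw [Aut.dist_mk]
  have h : {x | (swap R A hA hdA).1 x ≠ (swap R B hB hdB).1 x} ⊆
      symmDiff A B ∪ (R⁻¹).1 ⁻¹' symmDiff A B := by
    intro x hx
    change swapFun R.1 A x ≠ swapFun R.1 B x at hx
    change x ∈ symmDiff A B ∨ R.1.symm x ∈ symmDiff A B
    simp only [swapFun_eq_ite, mem_symmDiff] at hx ⊢
    grind
  have h2 := (measureReal_mono (μ := μ) h).trans (measureReal_union_le _ _)
  rw [measureReal_preimage_preAut] at h2
  linarith

/-! ### Sets whose involution lies in a given subgroup. -/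

theorem SwapMem.union {X : Type*} [MeasurableSpace X] {μ : Measure X} {G : Subgroup (Aut μ)}
    {R : preAut μ} {A B : Set X} (hA : SwapMem G R A) (hB : SwapMem G R B) (hAB : Disjoint A B)
    (hd : Disjoint (A ∪ B) (R.1 '' (A ∪ B))) : SwapMem G R (A ∪ B) := by
  obtain ⟨hA, hdA, hA'⟩ := hA
  obtain ⟨hB, hdB, hB'⟩ := hB
  refine ⟨hA.union hB, hd, ?_⟩
  rw [swap_union R hA hB hAB hd hdA hdB, map_mul]
  exact G.mul_mem hA' hB'

theorem SwapMem.sdiff {X : Type*} [MeasurableSpace X] {μ : Measure X} {G : Subgroup (Aut μ)}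
    {R : preAut μ} {A B : Set X} (hA : SwapMem G R A) (hB : SwapMem G R B) (hAB : A ⊆ B) :
    SwapMem G R (B \ A) := by
  obtain ⟨hA, hdA, hA'⟩ := hA
  obtain ⟨hB, hdB, hB'⟩ := hB
  have hd : Disjoint (B \ A) (R.1 '' (B \ A)) := hdB.mono sdiff_subset (image_mono sdiff_subset)
  refine ⟨hB.diff hA, hd, ?_⟩
  have e : A ∪ B \ A = B := union_sdiff_cancel hAB
  have hdU : Disjoint (A ∪ B \ A) (R.1 '' (A ∪ B \ A)) := by rwa [e]
  have h := swap_union R hA (hB.diff hA) disjoint_sdiff_right hdU hdA hd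
  simp only [e] at h
  rw [h, map_mul] at hB'
  exact (G.mul_mem_cancel_left hA').1 hB'

theorem SwapMem.empty {X : Type*} [MeasurableSpace X] {μ : Measure X} (G : Subgroup (Aut μ))
    (R : preAut μ) : SwapMem G R ∅ := by
  refine ⟨MeasurableSet.empty, by simp, ?_⟩
  have : swap R ∅ MeasurableSet.empty (by simp) = 1 :=
    Subtype.ext (Equiv.ext fun x => swapFun_of_notMem (by simp) (by simp))
  rw [this, map_one]
  exact G.one_mem

theorem tendsto_mk_swap {X κ : Type*} [MeasurableSpace X] {μ : Measure X} [IsFiniteMeasure μ]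
    {R : preAut μ} {l : Filter κ} {A : κ → Set X} {B : Set X} (hA : ∀ k, MeasurableSet (A k))
    (hdA : ∀ k, Disjoint (A k) (R.1 '' A k)) (hB : MeasurableSet B)
    (hd : Disjoint B (R.1 '' B)) (h : Tendsto (fun k => μ (symmDiff (A k) B)) l (𝓝 0)) :
    Tendsto (fun k => Aut.mk μ (swap R (A k) (hA k) (hdA k))) l
      (𝓝 (Aut.mk μ (swap R B hB hd))) := by
  rw [tendsto_iff_dist_tendsto_zero]
  have h' : Tendsto (fun k => 2 * μ.real (symmDiff (A k) B)) l (𝓝 0) := by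
    have := ((ENNReal.tendsto_toReal ENNReal.zero_ne_top).comp h).const_mul 2
    rwa [ENNReal.toReal_zero, mul_zero] at this
  exact squeeze_zero (fun _ => dist_nonneg) (fun k => dist_swap_le R _ _ _ _) h'

theorem SwapMem.of_tendsto {X κ : Type*} [MeasurableSpace X] {μ : Measure X} [IsFiniteMeasure μ]
    {G : Subgroup (Aut μ)} (hG : IsClosed (G : Set (Aut μ))) {R : preAut μ} {l : Filter κ}
    [l.NeBot] {A : κ → Set X} {B : Set X} (hA : ∀ k, SwapMem G R (A k)) (hB : MeasurableSet B)
    (hd : Disjoint B (R.1 '' B)) (h : Tendsto (fun k => μ (symmDiff (A k) B)) l (𝓝 0)) :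
    SwapMem G R B :=
  ⟨hB, hd, hG.mem_of_tendsto
    (tendsto_mk_swap (fun k => (hA k).fst) (fun k => (hA k).snd.fst) hB hd h)
    (Eventually.of_forall fun k => (hA k).snd.snd)⟩

/-- A π-λ argument starting from rays: complements within `J` come from `SwapMem.sdiff`, and
countable disjoint unions are limits of finite ones, `G` being closed. -/
theorem SwapMem.inter_preimage {X : Type*} [MeasurableSpace X] {μ : Measure X} [IsFiniteMeasure μ]
    {G : Subgroup (Aut μ)} (hG : IsClosed (G : Set (Aut μ))) {R : preAut μ} {J : Set X}
    (hJ : SwapMem G R J) {f : X → ℝ} (hf : Measurable f)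
    (h : ∀ c, SwapMem G R (J ∩ f ⁻¹' Iio c)) {D : Set ℝ} (hD : MeasurableSet D) :
    SwapMem G R (J ∩ f ⁻¹' D) := by
  have hd : ∀ D : Set ℝ, Disjoint (J ∩ f ⁻¹' D) (R.1 '' (J ∩ f ⁻¹' D)) := fun D =>
    hJ.snd.fst.mono inter_subset_left (image_mono inter_subset_left)
  induction D, hD using MeasurableSpace.induction_on_inter
    (borel_eq_generateFrom_Iio ℝ ▸ BorelSpace.measurable_eq) isPiSystem_Iio with
  | empty => simpa using SwapMem.empty G R
  | basic t ht => obtain ⟨c, rfl⟩ := ht; exact h c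
  | compl t ht ih =>
    have := ih.sdiff hJ inter_subset_left
    rwa [sdiff_self_inter, Set.sdiff_eq, ← preimage_compl] at this
  | iUnion F hF hFm ih =>
    have hU : ∀ m : ℕ, SwapMem G R (J ∩ f ⁻¹' ⋃ k ∈ Finset.range m, F k) := by
      intro m
      induction m with
      | zero => simpa using SwapMem.empty G R
      | succ m ihm =>
        have e : J ∩ f ⁻¹' (⋃ k ∈ Finset.range (m + 1), F k) =
            (J ∩ f ⁻¹' ⋃ k ∈ Finset.range m, F k) ∪ (J ∩ f ⁻¹' F m) := by
          rw [← inter_union_distrib_left, ← preimage_union, Finset.range_add_one,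
            Finset.set_biUnion_insert, union_comm]
        rw [e]
        refine ihm.union (ih m) ?_ (e ▸ hd _)
        refine Disjoint.mono inter_subset_right inter_subset_right (Disjoint.preimage f ?_)
        simp only [disjoint_iUnion_left]
        intro k hk
        exact hF (Finset.mem_range.1 hk).ne
    refine SwapMem.of_tendsto (l := atTop) hG hU
      (hJ.fst.inter (hf (MeasurableSet.iUnion hFm))) (hd _) ?_
    have hanti : Antitone fun m : ℕ =>
        symmDiff (J ∩ f ⁻¹' ⋃ k ∈ Finset.range m, F k) (J ∩ f ⁻¹' ⋃ k, F k) := by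
      intro m m' hm x hx
      simp only [mem_symmDiff, mem_inter_iff, mem_preimage, mem_iUnion, Finset.mem_range] at hx ⊢
      grind
    have hlim := tendsto_measure_iInter_atTop (μ := μ) (fun m : ℕ =>
      ((hU m).fst.symmDiff (hJ.fst.inter (hf (MeasurableSet.iUnion hFm)))).nullMeasurableSet)
      hanti ⟨0, measure_ne_top _ _⟩
    have e : ⋂ m : ℕ, symmDiff (J ∩ f ⁻¹' ⋃ k ∈ Finset.range m, F k) (J ∩ f ⁻¹' ⋃ k, F k) = ∅ := by
      refine eq_empty_of_forall_notMem fun x hx => ?_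
      simp only [mem_iInter, mem_symmDiff, mem_inter_iff, mem_preimage, mem_iUnion,
        Finset.mem_range] at hx
      rcases hx 0 with h0 | ⟨⟨hxJ, k, hk⟩, -⟩
      · simp at h0
      · rcases hx (k + 1) with h1 | h1
        · exact h1.2 ⟨hxJ, k, hk⟩
        · exact h1.2 ⟨hxJ, k, Nat.lt_succ_self k, hk⟩
    rwa [e, measure_empty] at hlim

/-! ### Exhausting an element of the full group by involutions. -/

/-- If sufficiently many of the involutions `R_C` belong to a closed subgroup `G`, then `G`
contains the full group. -/
theorem fullGroup_le_of_swapMem {X ι : Type*} [MeasurableSpace X] [MeasurableEq X]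
    {μ : Measure X} [IsFiniteMeasure μ] [Countable ι] [Nonempty ι] {G : Subgroup (Aut μ)}
    (hG : IsClosed (G : Set (Aut μ))) {E : Setoid X} {R : ι → preAut μ} {I : ι → Set X}
    (hI : ∀ j, MeasurableSet (I j)) (hE : ∀ j x, E x ((R j).1 x))
    (hmem : ∀ j, ∀ C ⊆ I j, MeasurableSet C → SwapMem G (R j) C)
    (hcover : ∀ x y, E x y → x ≠ y → ∃ j, x ∈ I j ∧ (R j).1 x = y) :
    fullGroup μ E ≤ G := by
  rintro _ ⟨S, rfl, hS⟩
  obtain ⟨e, he⟩ := exists_surjective_nat ι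
  -- The part of `I j` where `S` acts as `R j`. Following `S` by the involution over this set makes
  -- all its points fixed.
  let C : ι → preAut μ → Set X := fun j S => I j ∩ {x | S.1 x = (R j).1 x}
  have hC : ∀ j S, SwapMem G (R j) (C j S) := fun j S => hmem j _ inter_subset_left
    ((hI j).inter (measurableSet_eq_fun S.2.1.measurable (R j).2.1.measurable))
  let V : ι → preAut μ → preAut μ := fun j S => swap (R j) (C j S) (hC j S).fst (hC j S).snd.fst
  -- Unpairing makes every index recur infinitely often.
  let j : ℕ → ι := fun m => e m.unpair.1
  let s : ℕ → preAut μ := fun m => Nat.rec S (fun m S' => V (j m) S' * S') m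
  have hs0 : s 0 = S := rfl
  have hsucc : ∀ m x, (s (m + 1)).1 x = swapFun (R (j m)).1 (C (j m) (s m)) ((s m).1 x) :=
    fun m x => rfl
  have hsG : ∀ m, Aut.mk μ (s m) * (Aut.mk μ S)⁻¹ ∈ G := by
    intro m
    induction m with
    | zero => rw [hs0, mul_inv_cancel]; exact G.one_mem
    | succ m ih =>
      change Aut.mk μ (V (j m) (s m) * s m) * _ ∈ G
      rw [map_mul, mul_assoc]
      exact G.mul_mem (hC _ _).snd.snd ih
  -- Points already fixed are never moved again: the correction at stage `m` acts only on `C ∪ R C`,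
  -- which contains no fixed point of `s m`.
  have hnotMem : ∀ m x, (s m).1 x = x → x ∉ C (j m) (s m) ∧
      x ∉ (R (j m)).1 '' C (j m) (s m) := by
    intro m x hx
    have hd := (hC (j m) (s m)).snd.fst
    have h1 : x ∉ C (j m) (s m) := by
      intro h
      have h2 := disjoint_left.1 hd h
      have h3 : (R (j m)).1 x = x := h.2.symm.trans hx
      exact h2 ⟨x, h, h3⟩
    refine ⟨h1, ?_⟩
    rintro ⟨c, hc, hcx⟩
    have h2 : (s m).1 c = (s m).1 x := (hc.2.trans hcx).trans hx.symm
    exact h1 ((s m).1.injective h2 ▸ hc)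
  have hfix : ∀ m x, (s m).1 x = x → (s (m + 1)).1 x = x := by
    intro m x hx
    rw [hsucc, hx]
    exact swapFun_of_notMem (hnotMem m x hx).1 (hnotMem m x hx).2
  have hfix' : ∀ m m' x, m ≤ m' → (s m).1 x = x → (s m').1 x = x := by
    intro m m' x hm hx
    induction m', hm using Nat.le_induction with
    | base => exact hx
    | succ m' _ ih => exact hfix m' x ih
  have hCfix : ∀ m, ∀ x ∈ C (j m) (s m), (s (m + 1)).1 x = x := by
    intro m x hx
    rw [hsucc, hx.2]
    exact swapFun_apply_of_mem (hC _ _).snd.fst hx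
  have hdisj : Pairwise (Function.onFun Disjoint fun m => C (j m) (s m)) := by
    refine (pairwise_disjoint_on _).2 fun m m' hm => disjoint_left.2 fun x hx hx' => ?_
    exact (hnotMem m' x (hfix' (m + 1) m' x hm (hCfix m x hx))).1 hx'
  have hsum : ∑' m, μ (C (j m) (s m)) ≠ ⊤ := by
    refine ne_top_of_le_ne_top (measure_ne_top μ univ) (tsum_measure_le_measure_univ
      (fun m => (hC _ _).fst.nullMeasurableSet) fun m m' h => (hdisj h).aedisjoint)
  -- Points of `C (j m) (s m)` are fixed from then on, so these sets are disjoint and have summable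
  -- measure. By Borel–Cantelli almost every orbit `(s m).1 x` is eventually constant.
  have hsum' : ∑' m, μ ((s m).1 ⁻¹' (C (j m) (s m) ∪ (R (j m)).1 '' C (j m) (s m))) ≠ ⊤ := by
    refine ne_top_of_le_ne_top (ENNReal.mul_ne_top (ENNReal.ofNat_ne_top (n := 2)) hsum) ?_
    rw [← ENNReal.tsum_mul_left]
    refine ENNReal.tsum_le_tsum fun m => ?_
    have hm := (hC (j m) (s m)).fst
    rw [(s m).2.1.measure_preimage
      (hm.union (measurableSet_image_preAut _ hm)).nullMeasurableSet, two_mul]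
    refine (measure_union_le _ _).trans (add_le_add_right (le_of_eq ?_) _)
    rw [Equiv.image_eq_preimage_symm]
    exact (R (j m)).2.2.measure_preimage hm.nullMeasurableSet
  have hEs : ∀ᵐ x ∂μ, ∀ m, E x ((s m).1 x) := by
    filter_upwards [hS] with x hx m
    induction m with
    | zero => exact hx
    | succ m ih =>
      refine E.trans ih ?_
      rw [hsucc]
      by_cases h1 : (s m).1 x ∈ C (j m) (s m)
      · rw [swapFun_of_mem h1]
        exact hE _ _
      by_cases h2 : (s m).1 x ∈ (R (j m)).1 '' C (j m) (s m)
      · obtain ⟨y, hy, hyx⟩ := h2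
        rw [← hyx, swapFun_apply_of_mem (hC _ _).snd.fst hy]
        exact E.symm (hE _ _)
      · rw [swapFun_of_notMem h1 h2]
  have hev : ∀ᵐ x ∂μ, ∃ m, (s m).1 x = x := by
    filter_upwards [hEs, ae_eventually_notMem hsum'] with x hx hx'
    obtain ⟨N, hN⟩ := eventually_atTop.1 hx'
    have hconst : ∀ m, N ≤ m → (s m).1 x = (s N).1 x := by
      intro m hm
      induction m, hm using Nat.le_induction with
      | base => rfl
      | succ m hm ih =>
        have h := hN m hm
        rw [mem_preimage, mem_union, not_or] at h
        rw [hsucc, swapFun_of_notMem h.1 h.2, ih]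
    -- If the eventual value were not `x`, some `R i` would send `x` to it. The next stage after `N`
    -- that treats the index `i` would then fix `x`.
    by_contra! hne
    obtain ⟨i, hi, hiy⟩ := hcover x _ (hx N) (hne N).symm
    obtain ⟨a, rfl⟩ := he i
    have hj : j (Nat.pair a N) = e a := by simp only [j, Nat.unpair_pair]
    refine hne (Nat.pair a N + 1) (hCfix _ x ?_)
    rw [hj]
    exact ⟨hi, (hconst _ (Nat.right_le_pair a N)).trans hiy.symm⟩
  have hlim : Tendsto (fun m => dist (Aut.mk μ (s m)) 1) atTop (𝓝 0) := by
    have hm : ∀ m, MeasurableSet {x | (s m).1 x ≠ x} := fun m =>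
      (measurableSet_eq_fun (s m).2.1.measurable measurable_id).compl
    have h := tendsto_measure_iInter_atTop (μ := μ) (fun m => (hm m).nullMeasurableSet)
      (fun m m' hmm x hx hx' => hx (hfix' m m' x hmm hx')) ⟨0, measure_ne_top _ _⟩
    have h0 : μ (⋂ m, {x | (s m).1 x ≠ x}) = 0 := by
      rw [ae_iff] at hev
      refine measure_mono_null (fun x hx => ?_) hev
      simpa using hx
    rw [h0] at h
    exact (ENNReal.tendsto_toReal ENNReal.zero_ne_top).comp h
  have hlim' : Tendsto (fun m => Aut.mk μ (s m) * (Aut.mk μ S)⁻¹) atTop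
      (𝓝 (1 * (Aut.mk μ S)⁻¹)) :=
    (tendsto_iff_dist_tendsto_zero.2 hlim).mul_const _
  rw [one_mul] at hlim'
  exact G.inv_mem_iff.1 (hG.mem_of_tendsto hlim' (Eventually.of_forall hsG))

/-! ### Kronecker's theorem by Fourier series. -/

section Kronecker

noncomputable local instance : MeasureSpace UnitAddCircle := ⟨AddCircle.haarAddCircle⟩

local instance : Measure.IsAddHaarMeasure (volume : Measure UnitAddCircle) :=
  inferInstanceAs (Measure.IsAddHaarMeasure AddCircle.haarAddCircle)

theorem mFourier_apply_add {n : ℕ} (m : Fin n → ℤ) (x y : UnitAddTorus (Fin n)) :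
    UnitAddTorus.mFourier m (x + y) = UnitAddTorus.mFourier m x * UnitAddTorus.mFourier m y := by
  simp only [UnitAddTorus.mFourier, ContinuousMap.coe_mk, ← Finset.prod_mul_distrib, Pi.add_apply,
    fourier_apply, smul_add, AddCircle.toCircle_add, Circle.coe_mul]

/-- A character that is trivial at `α` gives an integer value of `∑ mᵢ αᵢ`, a rational relation with
`1`. -/
theorem mFourier_coe_ne_one {n : ℕ} {α : Fin n → ℝ}
    (hα : LinearIndependent ℚ (Fin.cons 1 α : Fin (n + 1) → ℝ)) {m : Fin n → ℤ} (hm : m ≠ 0) :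
    UnitAddTorus.mFourier m (fun i => (α i : UnitAddCircle)) ≠ 1 := by
  intro h
  have h1 : UnitAddTorus.mFourier m (fun i => (α i : UnitAddCircle)) =
      (AddCircle.toCircle (∑ i, m i • (α i : UnitAddCircle) : UnitAddCircle) : ℂ) := by
    simp only [UnitAddTorus.mFourier, ContinuousMap.coe_mk, fourier_apply]
    induction (Finset.univ : Finset (Fin n)) using Finset.cons_induction with
    | empty => simp
    | cons a s ha ih => rw [Finset.prod_cons, ih, Finset.sum_cons, AddCircle.toCircle_add,
        Circle.coe_mul]
  rw [h1] at h
  have h2 : (∑ i, m i • (α i : UnitAddCircle) : UnitAddCircle) = 0 := by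
    apply AddCircle.injective_toCircle one_ne_zero
    rw [AddCircle.toCircle_zero]
    exact Subtype.ext h
  have h3 : ((∑ i, m i • α i : ℝ) : UnitAddCircle) = 0 := by
    rw [← h2]
    exact map_sum (QuotientAddGroup.mk' (AddSubgroup.zmultiples (1 : ℝ))) _ _
  obtain ⟨k, hk⟩ := (AddCircle.coe_eq_zero_iff (1 : ℝ)).1 h3
  rw [Fintype.linearIndependent_iff] at hα
  have h4 := hα (Fin.cons (-k : ℚ) fun i => (m i : ℚ)) (by
    rw [Fin.sum_univ_succ]
    simp only [Fin.cons_zero, Fin.cons_succ, Rat.smul_def]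
    simp only [zsmul_eq_mul, mul_one] at hk
    push_cast
    rw [← hk]
    ring)
  refine hm (funext fun i => ?_)
  have := h4 i.succ
  simpa using this

/-- Kronecker's theorem: if `1, α₀, …, αₙ₋₁` are linearly independent over `ℚ`, then every closed
subgroup of the torus that contains `α` is the whole torus. -/
theorem eq_top_of_mem_of_linearIndependent {n : ℕ} {α : Fin n → ℝ}
    (hα : LinearIndependent ℚ (Fin.cons 1 α : Fin (n + 1) → ℝ))
    (H : AddSubgroup (UnitAddTorus (Fin n))) (hH : IsClosed (H : Set (UnitAddTorus (Fin n))))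
    (hmem : (fun i => (α i : UnitAddCircle)) ∈ H) : H = ⊤ := by
  set a : UnitAddTorus (Fin n) := fun i => (α i : UnitAddCircle) with ha
  -- The distance to `H` is invariant under translation by `a ∈ H`. Its nontrivial Fourier
  -- coefficients therefore vanish, so it is constant, equal to its value 0 at the origin.
  let f : C(UnitAddTorus (Fin n), ℂ) :=
    ⟨fun x => (Metric.infDist x (H : Set (UnitAddTorus (Fin n))) : ℂ),
      Complex.continuous_ofReal.comp (Metric.continuous_infDist_pt _)⟩
  have hf : ∀ x, f (x + a) = f x := by
    intro x
    refine congrArg (fun r : ℝ => (r : ℂ)) ?_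
    have e : (H : Set (UnitAddTorus (Fin n))) = (IsometryEquiv.addRight a) '' H := by
      ext y
      constructor
      · intro hy
        exact ⟨y - a, H.sub_mem hy hmem, sub_add_cancel y a⟩
      · rintro ⟨z, hz, rfl⟩
        exact H.add_mem hz hmem
    conv_lhs => rw [e]
    exact Metric.infDist_image (IsometryEquiv.addRight a).isometry
  have hcoeff : ∀ m, m ≠ 0 → UnitAddTorus.mFourierCoeff f m = 0 := by
    intro m hm
    have h1 : UnitAddTorus.mFourierCoeff f m =
        UnitAddTorus.mFourier (-m) a * UnitAddTorus.mFourierCoeff f m := by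
      conv_lhs => rw [UnitAddTorus.mFourierCoeff,
        ← integral_add_right_eq_self (μ := (volume : Measure (UnitAddTorus (Fin n)))) _ a]
      rw [UnitAddTorus.mFourierCoeff, ← integral_const_mul]
      refine integral_congr_ae (Eventually.of_forall fun x => ?_)
      simp only [hf, mFourier_apply_add, smul_eq_mul]
      ring
    have h2 := mFourier_coe_ne_one hα (neg_ne_zero.2 hm)
    by_contra h0
    exact h2 (mul_right_cancel₀ h0 (h1.symm.trans (one_mul _).symm))
  have hsum : Summable (UnitAddTorus.mFourierCoeff f) :=
    summable_of_ne_finset_zero (s := {0}) fun m hm => hcoeff m (by simpa using hm)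
  have hconst : ∀ x, f x = UnitAddTorus.mFourierCoeff f 0 := by
    intro x
    have h := UnitAddTorus.hasSum_mFourier_series_apply_of_summable hsum x
    rw [← h.tsum_eq, tsum_eq_single 0 fun m hm => by rw [hcoeff m hm, zero_smul],
      UnitAddTorus.mFourier_zero]
    simp
  refine (AddSubgroup.eq_top_iff' H).2 fun x => ?_
  have hx : f x = 0 := by
    rw [hconst x, ← hconst 0]
    exact congrArg (fun r : ℝ => (r : ℂ)) (Metric.infDist_zero_of_mem H.zero_mem)
  exact (hH.mem_iff_infDist_zero ⟨0, H.zero_mem⟩).2 (Complex.ofReal_eq_zero.1 hx)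

end Kronecker

/-! ### Arcs, strips and their translates. -/

/-- The representative in `[0, 1)` of an element of `ℝ/ℤ`. -/
noncomputable def unitRep (x : UnitAddCircle) : ℝ := (AddCircle.equivIco 1 0 x : ℝ)

theorem unitRep_nonneg (x : UnitAddCircle) : 0 ≤ unitRep x := (AddCircle.equivIco 1 0 x).2.1

theorem unitRep_lt_one (x : UnitAddCircle) : unitRep x < 1 := by
  simpa using! (AddCircle.equivIco 1 0 x).2.2

theorem coe_unitRep (x : UnitAddCircle) : (unitRep x : UnitAddCircle) = x :=
  (AddCircle.equivIco (1 : ℝ) 0).symm_apply_apply x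

theorem unitRep_coe {t : ℝ} (h0 : 0 ≤ t) (h1 : t < 1) : unitRep (t : UnitAddCircle) = t := by
  have ht : t ∈ Ico (0 : ℝ) (0 + 1) := ⟨h0, by linarith⟩
  rw [unitRep, AddCircle.equivIco_coe_eq ht]

theorem measurable_unitRep : Measurable unitRep :=
  measurable_subtype_coe.comp (AddCircle.measurableEquivIco 1 0).measurable

theorem unitRep_sub_of_le {x : UnitAddCircle} {s : ℝ} (h0 : 0 ≤ s) (h : s ≤ unitRep x) :
    unitRep (x - (s : UnitAddCircle)) = unitRep x - s := by
  conv_lhs => rw [← coe_unitRep x, ← AddCircle.coe_sub]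
  exact unitRep_coe (by linarith) (by linarith [unitRep_lt_one x])

theorem unitRep_sub_of_lt {x : UnitAddCircle} {s : ℝ} (h1 : s ≤ 1) (h : unitRep x < s) :
    unitRep (x - (s : UnitAddCircle)) = unitRep x - s + 1 := by
  conv_lhs => rw [← coe_unitRep x, ← AddCircle.coe_sub, ← AddCircle.coe_add_period (1 : ℝ)]
  exact unitRep_coe (by linarith [unitRep_nonneg x]) (by linarith)

/-- The strip `n × [0, β)`, translated by `y i` in the `i`th circle. -/
def shiftedStrip {n : ℕ} (y : Fin n → UnitAddCircle) (β : ℝ) : Set (Fin n × UnitAddCircle) :=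
  {p | unitRep (p.2 - y p.1) < β}

/-- The arc `[y, y + s)` in the `i`th circle. -/
def arc {n : ℕ} (i : Fin n) (y : UnitAddCircle) (s : ℝ) : Set (Fin n × UnitAddCircle) :=
  {p | p.1 = i ∧ unitRep (p.2 - y) < s}

theorem strip_eq_shiftedStrip (n : ℕ) {β : ℝ} (hβ : β ≤ 1) :
    strip n β = shiftedStrip (0 : Fin n → UnitAddCircle) β := by
  ext ⟨i, x⟩
  simp only [strip, shiftedStrip, mem_prod, mem_univ, true_and, mem_ofPred_eq, Pi.zero_apply,
    sub_zero]
  constructor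
  · rintro ⟨t, ht, rfl⟩
    simp only
    rw [unitRep_coe ht.1 (ht.2.trans_le hβ)]
    exact ht.2
  · exact fun h => ⟨unitRep x, ⟨unitRep_nonneg x, h⟩, coe_unitRep x⟩

theorem measurableSet_arc {n : ℕ} (i : Fin n) (y : UnitAddCircle) (s : ℝ) :
    MeasurableSet (arc i y s) :=
  (measurable_fst (measurableSet_singleton i)).inter
    (measurableSet_lt (measurable_unitRep.comp (measurable_snd.sub_const y)) measurable_const)

theorem arc_subset_shiftedStrip {n : ℕ} (i : Fin n) (y : UnitAddCircle) {s β : ℝ} (h : s ≤ β) :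
    arc i y s ⊆ shiftedStrip (fun _ => y) β := fun _ hp => hp.2.trans_le h

theorem arc_mono {n : ℕ} (i : Fin n) (y : UnitAddCircle) {s s' : ℝ} (h : s ≤ s') :
    arc i y s ⊆ arc i y s' := fun _ hp => ⟨hp.1, hp.2.trans_le h⟩

/-- Translation of each circle, as a continuous map that depends on the amount. -/
def translate {n : ℕ} (y : Fin n → UnitAddCircle) :
    C(Fin n × UnitAddCircle, Fin n × UnitAddCircle) where
  toFun p := (p.1, p.2 - y p.1)
  continuous_toFun := continuous_fst.prodMk
    (continuous_snd.sub ((continuous_of_discreteTopology (f := y)).comp continuous_fst))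

theorem continuous_translate {n : ℕ} : Continuous (translate (n := n)) := by
  refine ContinuousMap.continuous_of_continuous_uncurry _ ?_
  refine (continuous_fst.comp continuous_snd).prodMk
    ((continuous_snd.comp continuous_snd).sub ?_)
  have : Continuous fun q : Fin n × (Fin n → UnitAddCircle) => q.2 q.1 :=
    continuous_prod_of_discrete_left.2 fun i => continuous_apply i
  exact this.comp ((continuous_fst.comp continuous_snd).prodMk continuous_fst)

theorem measurePreserving_translate {n : ℕ} [NeZero n] (y : Fin n → UnitAddCircle) :
    MeasurePreserving (translate y) (circlesMeasure n) (circlesMeasure n) := by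
  have h := measurePreserving_rotation (fun i => -unitRep (y i))
  have e : (translate y : Fin n × UnitAddCircle → Fin n × UnitAddCircle) =
      fun p => (p.1, p.2 + ((-unitRep (y p.1) : ℝ) : UnitAddCircle)) := by
    funext p
    rw [AddCircle.coe_neg, coe_unitRep, ← sub_eq_add_neg]
    rfl
  rwa [e]

theorem tendsto_measure_symmDiff_translate {n : ℕ} [NeZero n] (y : Fin n → UnitAddCircle)
    {Z : Set (Fin n × UnitAddCircle)} (hZ : MeasurableSet Z) :
    Tendsto (fun y' => circlesMeasure n (symmDiff (translate y' ⁻¹' Z) (translate y ⁻¹' Z))) (𝓝 y)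
      (𝓝 0) :=
  tendsto_measure_symmDiff_preimage_nhds_zero (continuous_translate.tendsto y)
    (Eventually.of_forall measurePreserving_translate) (measurePreserving_translate y)
    hZ.nullMeasurableSet (measure_ne_top _ _)

theorem translate_preimage_strip {n : ℕ} {β : ℝ} (hβ : β ≤ 1) (y : Fin n → UnitAddCircle) :
    translate y ⁻¹' strip n β = shiftedStrip y β := by
  rw [strip_eq_shiftedStrip n hβ]
  ext p
  simp [shiftedStrip, translate]

theorem translate_preimage_arc {n : ℕ} (i : Fin n) (y : UnitAddCircle) (s : ℝ) :
    translate (fun _ => y) ⁻¹' arc i 0 s = arc i y s := by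
  ext p
  simp [arc, translate]

theorem measurableSet_shiftedStrip {n : ℕ} {β : ℝ} (hβ : β ≤ 1) (y : Fin n → UnitAddCircle) :
    MeasurableSet (shiftedStrip y β) := by
  rw [← translate_preimage_strip hβ y]
  exact (translate y).measurable (measurableSet_strip n β)

theorem disjoint_shiftedStrip {n : ℕ} [NeZero n] {α : Fin n → ℝ} {β : ℝ} (hβ : β ≤ 1)
    (hdisj : Disjoint (strip n β) ((rotation α).1 '' strip n β)) (y : Fin n → UnitAddCircle) :
    Disjoint (shiftedStrip y β) ((rotation α).1 '' shiftedStrip y β) := by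
  rw [← translate_preimage_strip hβ, disjoint_image_iff] at *
  intro p hp hp'
  refine hdisj _ hp ?_
  have e : (rotation α).1 (translate y p) = translate y ((rotation α).1 p) := by
    change (p.1, p.2 - y p.1 + _) = (p.1, p.2 + _ - y p.1)
    rw [sub_add_eq_add_sub]
    rfl
  rwa [e]

/-! ### From the strip to measurable subsets of short arcs. -/

theorem swapMem_shiftedStrip {n : ℕ} [NeZero n] {α : Fin n → ℝ}
    (hα : LinearIndependent ℚ (Fin.cons 1 α : Fin (n + 1) → ℝ)) {β : ℝ} (hβ : β ≤ 1)
    {G : Subgroup (Aut (circlesMeasure n))} (hG : IsClosed (G : Set (Aut (circlesMeasure n))))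
    (hT : Aut.mk _ (rotation α) ∈ G) (hU : SwapMem G (rotation α) (strip n β))
    (y : Fin n → UnitAddCircle) : SwapMem G (rotation α) (shiftedStrip y β) := by
  have hd := disjoint_shiftedStrip hβ hU.snd.fst
  let K : Set (Fin n → UnitAddCircle) := {y | SwapMem G (rotation α) (shiftedStrip y β)}
  have hK : IsClosed K := by
    have hcont : Continuous fun y : Fin n → UnitAddCircle =>
        Aut.mk _ (swap (rotation α) _ (measurableSet_shiftedStrip hβ y) (hd y)) := by
      refine continuous_iff_continuousAt.2 fun y => tendsto_mk_swap _ _ _ _ ?_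
      simp only [← translate_preimage_strip hβ]
      exact tendsto_measure_symmDiff_translate y (measurableSet_strip n β)
    have e : K = (fun y : Fin n → UnitAddCircle =>
        Aut.mk _ (swap (rotation α) _ (measurableSet_shiftedStrip hβ y) (hd y))) ⁻¹' G :=
      ext fun y => ⟨fun h => h.snd.snd, fun h => ⟨_, _, h⟩⟩
    rw [e]
    exact hG.preimage hcont
  -- The translations that preserve `K`, which itself need not be a subgroup. Conjugation by `T`
  -- shows that `α` is one of them, and `0 ∈ K` is the hypothesis on `U`.
  let H : AddSubgroup (Fin n → UnitAddCircle) :=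
    { carrier := {y | ∀ z ∈ K, z + y ∈ K ∧ z - y ∈ K}
      zero_mem' := fun z hz => by simpa using hz
      add_mem' := fun {y y'} hy hy' z hz =>
        ⟨by rw [← add_assoc]; exact (hy' _ (hy z hz).1).1,
          by rw [← sub_sub]; exact (hy' _ (hy z hz).2).2⟩
      neg_mem' := fun {y} hy z hz =>
        ⟨by rw [← sub_eq_add_neg]; exact (hy z hz).2, by rw [sub_neg_eq_add]; exact (hy z hz).1⟩ }
  have hH : IsClosed (H : Set (Fin n → UnitAddCircle)) := by
    have e : (H : Set (Fin n → UnitAddCircle)) =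
        ⋂ z ∈ K, (fun y => z + y) ⁻¹' K ∩ (fun y => z - y) ⁻¹' K := by
      ext y
      simp only [mem_iInter]
      rfl
    rw [e]
    exact isClosed_biInter fun z _ => (hK.preimage (continuous_const.add continuous_id)).inter
      (hK.preimage (continuous_const.sub continuous_id))
  have himage : ∀ z : Fin n → UnitAddCircle, (rotation α).1 '' shiftedStrip z β =
      shiftedStrip (z + fun i => (α i : UnitAddCircle)) β := by
    intro z
    rw [Equiv.image_eq_preimage_symm]
    ext p
    change unitRep (p.2 - _ - z p.1) < β ↔ unitRep (p.2 - (z p.1 + _)) < β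
    rw [sub_sub, add_comm]
  have hshift : ∀ z : Fin n → UnitAddCircle,
      z + (fun i => (α i : UnitAddCircle)) ∈ K ↔ z ∈ K := by
    intro z
    have hd' := hd (z + fun i => (α i : UnitAddCircle))
    have hm' := measurableSet_shiftedStrip hβ (z + fun i => (α i : UnitAddCircle))
    rw [← himage] at hd' hm'
    have h := swap_commuting_conj (rotation α) (rotation α) (Commute.refl _)
      (measurableSet_shiftedStrip hβ z) (hd z) hm' hd'
    change SwapMem _ _ _ ↔ SwapMem _ _ _
    rw [← himage]
    have h' : Aut.mk _ (swap (rotation α) _ hm' hd') ∈ G ↔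
        Aut.mk _ (swap (rotation α) _ (measurableSet_shiftedStrip hβ z) (hd z)) ∈ G := by
      rw [h, map_mul, map_mul, map_inv, G.mul_mem_cancel_right (G.inv_mem hT),
        G.mul_mem_cancel_left hT]
    exact ⟨fun h => ⟨_, _, h'.1 h.snd.snd⟩, fun h => ⟨_, _, h'.2 h.snd.snd⟩⟩
  have hmem : (fun i => (α i : UnitAddCircle)) ∈ H := fun z hz =>
    ⟨(hshift z).2 hz, (hshift _).1 (by rwa [sub_add_cancel])⟩
  have htop := eq_top_of_mem_of_linearIndependent hα H hH hmem
  have hy : y ∈ H := htop ▸ AddSubgroup.mem_top y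
  have h0 : (0 : Fin n → UnitAddCircle) ∈ K := by
    change SwapMem _ _ _
    rwa [← strip_eq_shiftedStrip n hβ]
  simpa using! (hy 0 h0).1

/-- Only the `i`th arc moves, and it loses its first piece of length `s`. The bound `s ≤ 1 - β`
keeps the moved arc from wrapping around onto that piece. -/
theorem shiftedStrip_sdiff {n : ℕ} (i : Fin n) (y : UnitAddCircle) {s β : ℝ} (hs : 0 ≤ s)
    (hsβ : s ≤ β) (hsβ' : s ≤ 1 - β) :
    shiftedStrip (fun _ => y) β \
      shiftedStrip (Function.update (fun _ => y) i (y + (s : UnitAddCircle))) β = arc i y s := by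
  ext ⟨j, x⟩
  simp only [shiftedStrip, arc, Set.mem_sdiff, mem_ofPred_eq]
  by_cases hj : j = i
  · subst hj
    simp only [Function.update_self, true_and, ← sub_sub]
    have h0 := unitRep_nonneg (x - y)
    rcases le_or_gt s (unitRep (x - y)) with h | h
    · rw [unitRep_sub_of_le hs h]
      constructor
      · rintro ⟨h1, h2⟩; linarith
      · intro h1; linarith
    · rw [unitRep_sub_of_lt (by linarith) h]
      constructor
      · exact fun _ => h
      · exact fun _ => ⟨by linarith, by linarith⟩
  · simp [hj]

theorem shiftedStrip_sdiff' {n : ℕ} (i : Fin n) (y : UnitAddCircle) {s β : ℝ} (hs : 0 ≤ s)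
    (hsβ : s ≤ β) (hsβ' : s ≤ 1 - β) :
    shiftedStrip (Function.update (fun _ => y) i (y + (s : UnitAddCircle))) β \
      shiftedStrip (fun _ => y) β = arc i (y + (β : UnitAddCircle)) s := by
  ext ⟨j, x⟩
  simp only [shiftedStrip, arc, Set.mem_sdiff, mem_ofPred_eq]
  by_cases hj : j = i
  · subst hj
    simp only [Function.update_self, true_and, ← sub_sub]
    have h0 := unitRep_nonneg (x - y)
    have h1 := unitRep_lt_one (x - y)
    rcases le_or_gt s (unitRep (x - y)) with h | h <;>
    rcases le_or_gt β (unitRep (x - y)) with h' | h'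
    · rw [unitRep_sub_of_le hs h, unitRep_sub_of_le (by linarith) h']
      constructor
      · rintro ⟨h1, h2⟩; linarith
      · exact fun h1 => ⟨by linarith, by linarith⟩
    · rw [unitRep_sub_of_le hs h, unitRep_sub_of_lt (by linarith) h']
      constructor
      · rintro ⟨h1, h2⟩; linarith
      · intro h1; linarith
    · linarith
    · rw [unitRep_sub_of_lt (by linarith) h, unitRep_sub_of_lt (by linarith) h']
      constructor
      · rintro ⟨h1, h2⟩; linarith
      · intro h1; linarith
  · simp [hj]

theorem arc_union_arc {n : ℕ} (i : Fin n) (y : UnitAddCircle) {s : ℝ} (hs : 0 ≤ s) :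
    arc i y s ∪ arc i (y + (s : UnitAddCircle)) s = arc i y (2 * s) := by
  ext ⟨j, x⟩
  simp only [arc, mem_union, mem_ofPred_eq, ← and_or_left, ← sub_sub]
  refine and_congr_right fun _ => ?_
  have h0 := unitRep_nonneg (x - y)
  have h1 := unitRep_lt_one (x - y)
  rcases le_or_gt s (unitRep (x - y)) with h | h
  · rw [unitRep_sub_of_le hs h]
    constructor
    · rintro (h | h) <;> linarith
    · exact fun h => Or.inr (by linarith)
  · exact ⟨fun _ => by linarith, fun _ => Or.inl h⟩

theorem disjoint_arc_arc {n : ℕ} (i : Fin n) (y : UnitAddCircle) {s : ℝ}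
    (hs : 2 * s ≤ 1) : Disjoint (arc i y s) (arc i (y + (s : UnitAddCircle)) s) := by
  refine disjoint_left.2 ?_
  rintro ⟨j, x⟩ ⟨-, h1⟩ ⟨-, h2⟩
  simp only [← sub_sub] at h1 h2
  rw [unitRep_sub_of_lt (by linarith) h1] at h2
  linarith [unitRep_nonneg (x - y)]

/-- The product of two involutions over `A` and `B` does not see `A ∩ B`. -/
theorem swap_mul_swap {X : Type*} [MeasurableSpace X] {μ : Measure X} (R : preAut μ) {A B : Set X}
    (hA : MeasurableSet A) (hB : MeasurableSet B) (hdA : Disjoint A (R.1 '' A))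
    (hdB : Disjoint B (R.1 '' B)) (hdAB : Disjoint (A \ B) (R.1 '' (A \ B)))
    (hdBA : Disjoint (B \ A) (R.1 '' (B \ A))) :
    swap R A hA hdA * swap R B hB hdB =
      swap R (A \ B) (hA.diff hB) hdAB * swap R (B \ A) (hB.diff hA) hdBA := by
  have hd : Disjoint (A ∩ B) (R.1 '' (A ∩ B)) :=
    hdA.mono inter_subset_left (image_mono inter_subset_left)
  have eA : A \ B ∪ A ∩ B = A := sdiff_union_inter A B
  have eB : A ∩ B ∪ B \ A = B := by rw [inter_comm]; exact inter_union_sdiff B A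
  have hA' := swap_union R (hA.diff hB) (hA.inter hB) disjoint_sdiff_inter (by rwa [eA]) hdAB hd
  have hB' := swap_union R (hA.inter hB) (hB.diff hA)
    (by rw [inter_comm]; exact disjoint_sdiff_inter.symm) (by rwa [eB]) hd hdBA
  simp only [eA] at hA'
  simp only [eB] at hB'
  rw [hA', hB', mul_assoc, ← mul_assoc (swap R (A ∩ B) _ _), swap_mul_self, one_mul]

/-- Since the `τ y` are involutions, `τ y τ(y+t) · τ(y+t) τ(y+t+u) = τ y τ(y+t+u)`. The `t` that
work for all `y` thus form a closed subgroup, which contains the irrational `β`. -/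
theorem mul_mem_of_dense {A : Type*} [Group A] [TopologicalSpace A] [IsTopologicalGroup A]
    {G : Subgroup A} (hG : IsClosed (G : Set A)) {τ : UnitAddCircle → A} (hτ : Continuous τ)
    (hτ2 : ∀ y, τ y * τ y = 1) {β : ℝ} (hβ : Irrational β)
    (h : ∀ y, τ y * τ (y + (β : UnitAddCircle)) ∈ G) (y t : UnitAddCircle) :
    τ y * τ (y + t) ∈ G := by
  have hinv : ∀ y, (τ y)⁻¹ = τ y := fun y => inv_eq_of_mul_eq_one_left (hτ2 y)
  let H : AddSubgroup UnitAddCircle :=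
    { carrier := {t | ∀ y, τ y * τ (y + t) ∈ G}
      zero_mem' := fun y => by rw [add_zero, hτ2]; exact G.one_mem
      add_mem' := fun {t u} ht hu y => by
        have := G.mul_mem (ht y) (hu (y + t))
        rwa [mul_assoc, ← mul_assoc (τ (y + t)), hτ2, one_mul, add_assoc] at this
      neg_mem' := fun {t} ht y => by
        have := G.inv_mem (ht (y + -t))
        rwa [mul_inv_rev, hinv, hinv, neg_add_cancel_right] at this }
  have hH : IsClosed (H : Set UnitAddCircle) := by
    have e : (H : Set UnitAddCircle) = ⋂ y, (fun t => τ y * τ (y + t)) ⁻¹' G := by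
      ext t
      simp only [mem_iInter]
      rfl
    rw [e]
    exact isClosed_iInter fun y => hG.preimage
      (continuous_const.mul (hτ.comp (continuous_const.add continuous_id)))
  have hdense : DenseRange fun k : ℤ => k • (β : UnitAddCircle) :=
    AddCircle.denseRange_zsmul_coe_iff.2 (by rwa [div_one])
  have htop : (H : Set UnitAddCircle) = univ := by
    refine eq_univ_of_univ_subset ?_
    rw [← hdense.closure_range]
    refine closure_minimal ?_ hH
    rintro _ ⟨k, rfl⟩
    exact H.zsmul_mem h k
  have ht : t ∈ (H : Set UnitAddCircle) := htop ▸ mem_univ t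
  exact ht y

theorem continuous_mk_swap_arc {n : ℕ} [NeZero n] {R : preAut (circlesMeasure n)} (i : Fin n)
    (s : ℝ) (hd : ∀ y, Disjoint (arc i y s) (R.1 '' arc i y s)) :
    Continuous fun y => Aut.mk _ (swap R _ (measurableSet_arc i y s) (hd y)) := by
  refine continuous_iff_continuousAt.2 fun y => tendsto_mk_swap _ _ _ _ ?_
  have hc : Continuous fun (y : UnitAddCircle) (_ : Fin n) => y :=
    continuous_pi fun _ => continuous_id
  have h := (tendsto_measure_symmDiff_translate (fun _ => y) (measurableSet_arc i 0 s)).comp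
    (hc.tendsto y)
  simpa only [Function.comp_def, translate_preimage_arc] using h

theorem swapMem_arc {n : ℕ} [NeZero n] {α : Fin n → ℝ}
    (hα : LinearIndependent ℚ (Fin.cons 1 α : Fin (n + 1) → ℝ)) {β : ℝ} (hβ : β ≤ 1)
    (hβirr : Irrational β)
    {G : Subgroup (Aut (circlesMeasure n))} (hG : IsClosed (G : Set (Aut (circlesMeasure n))))
    (hT : Aut.mk _ (rotation α) ∈ G) (hU : SwapMem G (rotation α) (strip n β))
    (i : Fin n) (y : UnitAddCircle) {s : ℝ} (hs : 0 ≤ s) (hsβ : 2 * s ≤ β) (hsβ' : s ≤ 1 - β) :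
    SwapMem G (rotation α) (arc i y (2 * s)) := by
  have hstrip := swapMem_shiftedStrip hα hβ hG hT hU
  have hd : ∀ y s, s ≤ β → Disjoint (arc i y s) ((rotation α).1 '' arc i y s) := fun y s h =>
    (hstrip fun _ => y).snd.fst.mono (arc_subset_shiftedStrip i y h)
      (image_mono (arc_subset_shiftedStrip i y h))
  have hsβ1 : s ≤ β := by linarith
  -- At distance `t = s` the two arcs of length `s` are adjacent, which is why the conclusion
  -- concerns length `2 * s`.
  have key := mul_mem_of_dense hG (continuous_mk_swap_arc i s fun y => hd y s hsβ1)
    (fun y => by rw [← map_mul, swap_mul_self, map_one]) hβirr (fun y => ?_) y s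
  · have e := arc_union_arc i y hs
    have h := swap_union (rotation α) (measurableSet_arc i y s) (measurableSet_arc i (y + s) s)
      (disjoint_arc_arc i y (by linarith)) (by rw [e]; exact hd _ _ hsβ) (hd _ _ hsβ1)
      (hd _ _ hsβ1)
    rw [← map_mul, ← h] at key
    rw [← e]
    exact ⟨_, _, key⟩
  -- The involutions over the strip and over its copy moved by `s` in circle `i` cancel on the
  -- overlap, leaving the arcs at `y` and `y + β`.
  · obtain ⟨hA, hdA, hA'⟩ := hstrip fun _ => y
    obtain ⟨hB, hdB, hB'⟩ := hstrip (Function.update (fun _ => y) i (y + (s : UnitAddCircle)))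
    have e1 := shiftedStrip_sdiff i y hs hsβ1 hsβ'
    have e2 := shiftedStrip_sdiff' i y hs hsβ1 hsβ'
    have h := swap_mul_swap (rotation α) hA hB hdA hdB (by rw [e1]; exact hd _ _ hsβ1)
      (by rw [e2]; exact hd _ _ hsβ1)
    simp only [e1, e2] at h
    have h' := G.mul_mem hA' hB'
    rwa [← map_mul, h, map_mul] at h'

/-- The coordinate `unitRep (p.2 - y)` identifies the arc with an interval; the preimages of rays in
it are initial subarcs. -/
theorem swapMem_of_subset_arc {n : ℕ} [NeZero n] {R : preAut (circlesMeasure n)}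
    {G : Subgroup (Aut (circlesMeasure n))} (hG : IsClosed (G : Set (Aut (circlesMeasure n))))
    (i : Fin n) (y : UnitAddCircle) {s : ℝ} (h : ∀ t ≤ s, SwapMem G R (arc i y t))
    {C : Set (Fin n × UnitAddCircle)} (hC : C ⊆ arc i y s) (hCm : MeasurableSet C) :
    SwapMem G R C := by
  have hf : Measurable fun p : Fin n × UnitAddCircle => unitRep (p.2 - y) :=
    measurable_unitRep.comp (measurable_snd.sub_const y)
  have hcoe : Measurable fun v : ℝ => (v : UnitAddCircle) :=
    (AddCircle.continuous_mk' (1 : ℝ)).measurable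
  have hg : Measurable fun v : ℝ => (i, y + (v : UnitAddCircle)) :=
    measurable_const.prodMk (hcoe.const_add y)
  have key := SwapMem.inter_preimage hG (h s le_rfl) hf (fun c => ?_) (hg hCm)
  · have e : arc i y s ∩ (fun p : Fin n × UnitAddCircle => unitRep (p.2 - y)) ⁻¹'
        ((fun v : ℝ => (i, y + (v : UnitAddCircle))) ⁻¹' C) = C := by
      ext ⟨j, x⟩
      simp only [mem_inter_iff, mem_preimage, coe_unitRep, add_sub_cancel]
      constructor
      · rintro ⟨⟨rfl, -⟩, h2⟩
        exact h2
      · intro hj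
        have hj' := hC hj
        obtain ⟨rfl, -⟩ := id hj'
        exact ⟨hj', hj⟩
    rwa [e] at key
  · have e : arc i y s ∩ (fun p : Fin n × UnitAddCircle => unitRep (p.2 - y)) ⁻¹' Iio c =
        arc i y (min c s) := by
      ext p
      simp only [arc, mem_inter_iff, mem_preimage, mem_ofPred_eq, mem_Iio, lt_min_iff]
      tauto
    rw [e]
    exact h _ (min_le_right _ _)

/-! ### Involutions of the powers of `T`. -/

theorem rotation_zpow_apply {n : ℕ} [NeZero n] (α : Fin n → ℝ) (k : ℤ)
    (p : Fin n × UnitAddCircle) :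
    (rotation α ^ k).1 p = (p.1, p.2 + k • (α p.1 : UnitAddCircle)) := by
  induction k using Int.induction_on generalizing p with
  | zero => simp
  | succ k ih =>
    rw [zpow_add_one]
    change (rotation α ^ (k : ℤ)).1 (p.1, p.2 + (α p.1 : UnitAddCircle)) = _
    rw [ih, add_zsmul, one_zsmul, add_assoc, add_comm (α p.1 : UnitAddCircle)]
  | pred k ih =>
    rw [zpow_sub_one]
    change (rotation α ^ (-k : ℤ)).1 (p.1, p.2 - (α p.1 : UnitAddCircle)) = _
    rw [ih, sub_zsmul, one_zsmul, sub_add_eq_add_sub, add_sub_assoc, ← sub_eq_add_neg]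

theorem orbitEquiv_iff {X : Type*} [MeasurableSpace X] {μ : Measure X} (T : preAut μ) {x y : X} :
    orbitEquiv T x y ↔ ∃ k : ℤ, (T ^ k).1 x = y := by
  change (∃ k : ℤ, (T.1 ^ k) x = y) ↔ _
  simp only [Subgroup.coe_zpow]

theorem zsmul_coe_ne_zero {n : ℕ} {α : Fin n → ℝ}
    (hα : LinearIndependent ℚ (Fin.cons 1 α : Fin (n + 1) → ℝ)) (i : Fin n) {k : ℤ} (hk : k ≠ 0) :
    k • (α i : UnitAddCircle) ≠ 0 := by
  intro h
  refine mFourier_coe_ne_one hα (m := Pi.single i k) (by simpa using hk) ?_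
  simp only [UnitAddTorus.mFourier, ContinuousMap.coe_mk, fourier_apply]
  refine Finset.prod_eq_one fun j _ => ?_
  by_cases hj : j = i
  · subst hj
    rw [Pi.single_eq_same, h, AddCircle.toCircle_zero, Circle.coe_one]
  · rw [Pi.single_eq_of_ne hj, zero_smul, AddCircle.toCircle_zero, Circle.coe_one]

theorem image_rotation_zpow_subset_arc {n : ℕ} [NeZero n] {α : Fin n → ℝ} (k : ℤ) {i : Fin n}
    {y : UnitAddCircle} {s : ℝ} {C : Set (Fin n × UnitAddCircle)} (hC : C ⊆ arc i y s) :
    (rotation α ^ k).1 '' C ⊆ arc i (y + k • (α i : UnitAddCircle)) s := by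
  rintro _ ⟨p, hp, rfl⟩
  obtain ⟨rfl, h⟩ := hC hp
  rw [rotation_zpow_apply]
  exact ⟨rfl, by rwa [add_sub_add_right_eq_sub]⟩

/-- On circle `i`, `T ^ k` is a rotation by some `c ∈ (0, 1)`, so an arc of length at most `min c (1
- c)` is disjoint from its image. -/
theorem exists_disjoint_rotation_zpow {n : ℕ} [NeZero n] {α : Fin n → ℝ}
    (hα : LinearIndependent ℚ (Fin.cons 1 α : Fin (n + 1) → ℝ)) (i : Fin n) {k : ℤ} (hk : k ≠ 0) :
    ∃ δ > 0, ∀ y, ∀ C ⊆ arc i y δ, Disjoint C ((rotation α ^ k).1 '' C) := by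
  set c := unitRep (k • (α i : UnitAddCircle)) with hc
  have hcoe : (c : UnitAddCircle) = k • (α i : UnitAddCircle) := coe_unitRep _
  have hc0 : 0 < c := by
    refine (unitRep_nonneg _).lt_of_ne fun h => zsmul_coe_ne_zero hα i hk ?_
    rw [← hcoe, hc, ← h, AddCircle.coe_zero]
  have hc1 : c < 1 := unitRep_lt_one _
  refine ⟨min c (1 - c), lt_min hc0 (by linarith), fun y C hC => disjoint_right.2 fun p hp hp' => ?_⟩
  have h1 := (hC hp').2
  have h2 := (image_rotation_zpow_subset_arc k hC hp).2
  rw [lt_min_iff] at h1 h2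
  rw [← hcoe, ← sub_sub, unitRep_sub_of_lt hc1.le h1.1] at h2
  linarith [unitRep_nonneg (p.2 - y)]

theorem SwapMem.comp {X : Type*} [MeasurableSpace X] {μ : Measure X} {G : Subgroup (Aut μ)}
    {R R' : preAut μ} {A : Set X} (hA : SwapMem G R A) (hA' : SwapMem G R' (R.1 '' A))
    (hd : Disjoint A ((R' * R).1 '' A)) : SwapMem G (R' * R) A := by
  obtain ⟨hA, hdA, h⟩ := hA
  obtain ⟨hB, hdB, h'⟩ := hA'
  refine ⟨hA, hd, ?_⟩
  rw [swap_comp R R' hA hB hdA hdB hd, map_mul, map_mul]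
  exact G.mul_mem (G.mul_mem h' h) h'

theorem SwapMem.symm {X : Type*} [MeasurableSpace X] {μ : Measure X} {G : Subgroup (Aut μ)}
    {R : preAut μ} {A : Set X} (hA : SwapMem G R A) : SwapMem G R⁻¹ (R.1 '' A) := by
  obtain ⟨hA, hdA, h⟩ := hA
  have e : (R⁻¹).1 '' (R.1 '' A) = A := R.1.symm_image_image A
  have hd : Disjoint (R.1 '' A) ((R⁻¹).1 '' (R.1 '' A)) := by rw [e]; exact hdA.symm
  refine ⟨measurableSet_image_preAut R hA, hd, ?_⟩
  rwa [swap_symm R hA hdA]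

/-- Induction through `swap_comp`. Uniformity in `y` is essential: the involution of `T` is needed
over the image of `C`, which lies in another arc of the same length. -/
theorem exists_swapMem_rotation_pow {n : ℕ} [NeZero n] {α : Fin n → ℝ}
    (hα : LinearIndependent ℚ (Fin.cons 1 α : Fin (n + 1) → ℝ))
    {G : Subgroup (Aut (circlesMeasure n))} {i : Fin n}
    (h : ∃ δ > 0, ∀ y, ∀ C ⊆ arc i y δ, MeasurableSet C → SwapMem G (rotation α) C) (k : ℕ) :
    ∃ δ > 0, ∀ y, ∀ C ⊆ arc i y δ, MeasurableSet C → SwapMem G (rotation α ^ (k + 1)) C := by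
  induction k with
  | zero => simpa using h
  | succ k ih =>
    obtain ⟨δ, hδ, h⟩ := h
    obtain ⟨δ', hδ', h'⟩ := ih
    obtain ⟨ε, hε, hd⟩ := exists_disjoint_rotation_zpow hα i (k := (k + 1 + 1 : ℕ)) (by omega)
    refine ⟨min (min δ δ') ε, lt_min (lt_min hδ hδ') hε, fun y C hC hCm => ?_⟩
    have hCδ := hC.trans (arc_mono i y ((min_le_left _ _).trans (min_le_left _ _)))
    have hCδ' := hC.trans (arc_mono i y ((min_le_left _ _).trans (min_le_right _ _)))
    have hCd := hd y C (hC.trans (arc_mono i y (min_le_right _ _)))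
    have hsub := image_rotation_zpow_subset_arc (α := α) (k + 1 : ℕ) hCδ
    rw [zpow_natCast] at hsub hCd
    rw [pow_succ'] at hCd ⊢
    exact (h' y C hCδ' hCm).comp (h _ _ hsub (measurableSet_image_preAut _ hCm)) hCd

theorem exists_swapMem_rotation_zpow {n : ℕ} [NeZero n] {α : Fin n → ℝ}
    (hα : LinearIndependent ℚ (Fin.cons 1 α : Fin (n + 1) → ℝ))
    {G : Subgroup (Aut (circlesMeasure n))} {i : Fin n}
    (h : ∃ δ > 0, ∀ y, ∀ C ⊆ arc i y δ, MeasurableSet C → SwapMem G (rotation α) C) {k : ℤ}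
    (hk : k ≠ 0) :
    ∃ δ > 0, ∀ y, ∀ C ⊆ arc i y δ, MeasurableSet C → SwapMem G (rotation α ^ k) C := by
  obtain ⟨m, hm⟩ := Nat.exists_eq_succ_of_ne_zero (Int.natAbs_ne_zero.2 hk)
  obtain ⟨δ, hδ, h'⟩ := exists_swapMem_rotation_pow hα h m
  refine ⟨δ, hδ, fun y C hC hCm => ?_⟩
  rcases Int.natAbs_eq k with hk' | hk' <;> rw [hk', hm]
  · rw [zpow_natCast]
    exact h' y C hC hCm
  · rw [zpow_neg, zpow_natCast]
    have e : (rotation α ^ (m + 1)).1 '' ((rotation α ^ (-(m + 1 : ℕ) : ℤ)).1 '' C) = C := by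
      rw [zpow_neg, zpow_natCast]
      exact (rotation α ^ (m + 1)).1.image_symm_image C
    have := (h' _ _ (image_rotation_zpow_subset_arc (α := α) (-(m + 1 : ℕ) : ℤ) hC)
      (measurableSet_image_preAut _ hCm)).symm
    rwa [e] at this

theorem exists_mem_arc {n : ℕ} (p : Fin n × UnitAddCircle) {δ : ℝ} (hδ : 0 < δ) :
    ∃ a : ℕ, p ∈ arc p.1 ((a * δ : ℝ) : UnitAddCircle) δ := by
  have h0 := unitRep_nonneg p.2
  have h1 : ⌊unitRep p.2 / δ⌋₊ * δ ≤ unitRep p.2 :=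
    (le_div_iff₀ hδ).1 (Nat.floor_le (by positivity))
  refine ⟨⌊unitRep p.2 / δ⌋₊, rfl, ?_⟩
  rw [unitRep_sub_of_le (by positivity) h1]
  have h2 := (div_lt_iff₀ hδ).1 (Nat.lt_floor_add_one (unitRep p.2 / δ))
  linarith

/-! ### Conclusion. -/

theorem fullGroup_orbitEquiv_rotation_le {n : ℕ} [NeZero n] {α : Fin n → ℝ}
    (hα : LinearIndependent ℚ (Fin.cons 1 α : Fin (n + 1) → ℝ)) {β : ℝ}
    (hβ : β ∈ Ioo (0 : ℝ) 1) (hβirr : Irrational β)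
    {G : Subgroup (Aut (circlesMeasure n))} (hG : IsClosed (G : Set (Aut (circlesMeasure n))))
    (hT : Aut.mk _ (rotation α) ∈ G) (hU : SwapMem G (rotation α) (strip n β)) :
    fullGroup (circlesMeasure n) (orbitEquiv (rotation α)) ≤ G := by
  have h1 : ∀ i : Fin n, ∃ δ > 0, ∀ y, ∀ C ⊆ arc i y δ, MeasurableSet C →
      SwapMem G (rotation α) C := by
    intro i
    -- With `t = 2s`, `t ≤ β` and `t ≤ 1 - β` yield the bounds `2s ≤ β` and `s ≤ 1 - β` of
    -- `swapMem_arc`. For negative `t` the arc is empty.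
    refine ⟨min β (1 - β), lt_min hβ.1 (by linarith [hβ.2]), fun y C hC hCm =>
      swapMem_of_subset_arc hG i y (fun t ht => ?_) hC hCm⟩
    rw [le_min_iff] at ht
    rcases le_or_gt 0 t with h0 | h0
    · have := swapMem_arc hα hβ.2.le hβirr hG hT hU i y (s := t / 2) (by linarith) (by linarith)
        (by linarith)
      rwa [mul_div_cancel₀ _ two_ne_zero] at this
    · have e : arc i y t = ∅ := eq_empty_of_forall_notMem fun p hp =>
        (hp.2.trans h0).not_ge (unitRep_nonneg _)
      rw [e]
      exact SwapMem.empty G _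
  have h2 : ∀ q : {k : ℤ // k ≠ 0} × Fin n, ∃ δ > 0, ∀ y, ∀ C ⊆ arc q.2 y δ, MeasurableSet C →
      SwapMem G (rotation α ^ q.1.1) C := fun q => exists_swapMem_rotation_zpow hα (h1 q.2) q.1.2
  choose δ hδ hmem using h2
  have : Nonempty (({k : ℤ // k ≠ 0} × Fin n) × ℕ) := ⟨((⟨1, one_ne_zero⟩, 0), 0)⟩
  -- An index consists of a nonzero power, a circle and the position of an arc. The arcs starting at
  -- the multiples of `δ` cover the circle.
  refine fullGroup_le_of_swapMem (ι := ({k : ℤ // k ≠ 0} × Fin n) × ℕ) hG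
    (R := fun q => rotation α ^ q.1.1.1)
    (I := fun q => arc q.1.2 ((q.2 * δ q.1 : ℝ) : UnitAddCircle) (δ q.1))
    (fun q => measurableSet_arc _ _ _) (fun q x => (orbitEquiv_iff _).2 ⟨_, rfl⟩)
    (fun q => hmem q.1 _) fun x y hxy hne => ?_
  obtain ⟨k, rfl⟩ := (orbitEquiv_iff _).1 hxy
  have hk : k ≠ 0 := by
    rintro rfl
    exact hne (by simp)
  obtain ⟨a, ha⟩ := exists_mem_arc x (hδ (⟨k, hk⟩, x.1))
  exact ⟨((⟨k, hk⟩, x.1), a), ha, rfl⟩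

theorem mk_mem_fullGroup_orbitEquiv {X : Type*} [MeasurableSpace X] {μ : Measure X}
    (T : preAut μ) : Aut.mk μ T ∈ fullGroup μ (orbitEquiv T) :=
  ⟨T, rfl, Eventually.of_forall fun _ => (orbitEquiv_iff T).2 ⟨1, by rw [zpow_one]⟩⟩

theorem mk_swap_mem_fullGroup_orbitEquiv {X : Type*} [MeasurableSpace X] {μ : Measure X}
    (T : preAut μ) {A : Set X} (hA : MeasurableSet A) (hd : Disjoint A (T.1 '' A)) :
    Aut.mk μ (swap T A hA hd) ∈ fullGroup μ (orbitEquiv T) := by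
  refine ⟨_, rfl, Eventually.of_forall fun x => (orbitEquiv_iff T).2 ?_⟩
  change ∃ k : ℤ, (T ^ k).1 x = swapFun T.1 A x
  by_cases h1 : x ∈ A
  · exact ⟨1, by rw [swapFun_of_mem h1, zpow_one]⟩
  by_cases h2 : x ∈ T.1 '' A
  · obtain ⟨y, hy, rfl⟩ := h2
    refine ⟨-1, ?_⟩
    rw [swapFun_apply_of_mem hd hy, zpow_neg_one]
    exact T.1.symm_apply_apply y
  · exact ⟨0, by rw [swapFun_of_notMem h1 h2, zpow_zero]; rfl⟩

end PMP


theorem mainTheorem3 (n : ℕ) [NeZero n] (α : Fin n → ℝ)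
    (hα : LinearIndependent ℚ (Fin.cons 1 α : Fin (n + 1) → ℝ))
    (β : ℝ) (hβ : β ∈ Set.Ioo (0 : ℝ) 1) (hβirr : Irrational β) (hβα : ∀ i, β < α i)
    (hdisj : Disjoint (PMP.strip n β) ((PMP.rotation α).1 '' PMP.strip n β)) :
    PMP.AreTopologicalGenerators (PMP.circlesMeasure n)
      {PMP.Aut.mk _ (PMP.rotation α),
        PMP.Aut.mk _ (PMP.swap (PMP.rotation α) (PMP.strip n β)
          (PMP.measurableSet_strip n β) hdisj)}
      (PMP.orbitEquiv (PMP.rotation α)) := by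
  refine Subset.antisymm (closure_minimal ?_ (PMP.isClosed_fullGroup _ _)) ?_
  · refine SetLike.coe_subset_coe.2 ((Subgroup.closure_le _).2 ?_)
    rintro _ (rfl | rfl)
    · exact PMP.mk_mem_fullGroup_orbitEquiv _
    · exact PMP.mk_swap_mem_fullGroup_orbitEquiv _ _ _
  · have hmem := fun g hg => Subgroup.le_topologicalClosure _ (Subgroup.subset_closure (k :=
      {PMP.Aut.mk _ (PMP.rotation α), PMP.Aut.mk _ (PMP.swap (PMP.rotation α) (PMP.strip n β)
        (PMP.measurableSet_strip n β) hdisj)}) (a := g) hg)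
    exact PMP.fullGroup_orbitEquiv_rotation_le hα hβ hβirr
      (Subgroup.isClosed_topologicalClosure _) (hmem _ (Or.inl rfl))
      ⟨_, _, hmem _ (Or.inr rfl)⟩
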